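/- Let $j\ge 2$ be an even integer, $N=2j$, and let $a,b,\alpha$ be real numbers with $0\le\alpha\le 1$ and either ($a<-j$ and $|b|<1$) or ($b>j-1$ and $|a+1|<1$). Write $(x)_k=x(x+1)\cdots(x+k-1)$. For $0\le n\le 2j$ put $$A_n=\begin{cases}-\frac14(n-j-a)& n\text{ even},\ n\ne j\\ \frac12(1-\alpha)a& n=j\\ -\frac14\frac{(n+1)(n-j-b)}{n-j}& n\text{ odd}\end{cases},\qquad C_n=\begin{cases}\frac14(n-j+a)& n\text{ even},\ n\ne j\\ \frac12\alpha a& n=j\\ \frac14\frac{(n-2j-1)(n-j+b)}{n-j}& n\text{ odd}\end{cases},$$ $u_0=0$ and $u_n=A_{n-1}C_n$ for $1\le n\le 2j$. Let $P_n=\mathbf P^{(0)}_n(x;a,b,\alpha,2j)$, $0\le n\le 2j+1$, be the monic para-Bannai-Ito polynomials, defined by $P_0=1$, $P_{-1}=0$ and $$xP_n=P_{n+1}+\Big(\tfrac{b-j-1+a}{4}-A_n-C_n\Big)P_n+u_nP_{n-1}.$$ Let $x_0,\dots,x_{2j}$ be the bi-lattice $$x_{2s}=-(-1)^s\tfrac{2s-j-b+a}{4}-\tfrac14\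 (0\le s\le j),\qquad x_{2s+1}=-(-1)^s\tfrac{2s-j-b-a}{4}-\tfrac14\ (0\le s\le j-1).$$ Put $$\tilde h=\frac{(1)_j\,(\frac{b+1-j}{2})_j\,(-\frac{j+a}{2})_j}{2^{2j}(\frac{1-j}{2})_j}$$ and define the persymmetric weights $\tilde w_0,\dots,\tilde w_{2j}$ by $$\tilde w_{4s}=\frac{\tilde h}{(-s)_s(1)_{j/2-s}(-s-\frac a2)_{j/2}(s+\frac{1+a-b-j}{2})_{j/2}(s+\frac{1-b-j}{2})_{j/2}},$$ $$\tilde w_{4s+1}=-\frac{\tilde h}{(-s)_s(1)_{j/2-s-1}(-s+\frac a2)_{j/2+1}(s+\frac{1-a-b-j}{2})_{j/2}(s+\frac{1-b-j}{2})_{j/2}},$$ $$\tilde w_{4s+2}=-\frac{\tilde h}{(-s)_s(1)_{j/2-s-1}(-s-\frac a2)_{j/2}(s+\frac{1+a-b-j}{2})_{j/2+1}(s+\frac{1-b-j}{2})_{j/2}},$$ $$\tilde w_{4s+3}=\frac{\tilde h}{(-s)_s(1)_{j/2-s-1}(-s+\frac a2)_{j/2}(s+\frac{1-a-b-j}{2})_{j/2}(s+\frac{1-b-j}{2})_{j/2+1}},$$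 and the weights $w_{2s}=2\alpha\,\tilde w_{2s}$, $w_{2s+1}=2(1-\alpha)\,\tilde w_{2s+1}$. Then: 1. The points $x_0,\dots,x_{2j}$ are pairwise distinct and $P_{2j+1}(x)=\prod_{s=0}^{2j}(x-x_s)$. 2. (Orthogonality) For all $0\le n,m\le 2j$, $\displaystyle\sum_{s=0}^{2j}w_sP_n(x_s)P_m(x_s)=u_1\cdots u_n\,\delta_{nm}$. 3. If $0<\alpha<1$, then $\displaystyle w_s=\frac{u_1\cdots u_{2j}}{P_{2j}(x_s)P_{2j+1}'(x_s)}$ for $0\le s\le 2j$. Moreover, with all $u_n$ and $P_{2j+1}$ taken at $\alpha=\frac12$, $\displaystyle\tilde w_s=\frac{(-1)^s\sqrt{u_1\cdots u_{2j}}}{P_{2j+1}'(x_s)}$ for $0\le s\le 2j$, and $\sqrt{u_1\cdots u_{2j}}=\tilde h$. 4. $\displaystyle\sum_{s=0}^{j}w_{2s}=\alpha$ and $\displaystyle\sum_{s=0}^{j-1}w_{2s+1}=1-\alpha$. 5. (Norms) $u_1\cdots u_{2n}=h_{2n}^2$ for $0\le n\le j$ and $u_1\cdots u_{2n+1}=h_{2n+1}^2$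 for $0\le n\le j-1$, where $$h_{2n}=\frac{\sqrt{(-j)_n(1)_n(\frac{1+b-j}{2})_n(\frac{1-b-j}{2})_n(-\frac{j+a}{2})_n(\frac{2+a-j}{2})_n}}{2^{2n}\,\big|(\frac{1-j}{2})_n\big|}\times\begin{cases}1&n<\frac j2\\ \sqrt{2\alpha}&n=\frac j2\\ 2\sqrt{\alpha(1-\alpha)}&n>\frac j2\end{cases},$$ $$h_{2n+1}=\frac1{2^{2n+1}}\sqrt{\frac{-(-j)_{n+1}(1)_n(\frac{1+b-j}{2})_{n+1}(\frac{1-b-j}{2})_n(-\frac{j+a}{2})_{n+1}(\frac{2+a-j}{2})_n}{(\frac{1-j}{2})_n(\frac{1-j}{2})_{n+1}}}\times\begin{cases}1&n<\frac j2\\ 2\sqrt{\alpha(1-\alpha)}&n\ge\frac j2\end{cases}.$$ -/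

import Mathlib

namespace ParaBI

open Polynomial

/-- The Pochhammer symbol `(x)_k = x (x+1) ... (x+k-1)`. -/
noncomputable def poch (x : ℝ) (k : ℕ) : ℝ := (ascPochhammer ℝ k).eval x

/-- The coefficient `A_n` (for `N = 2j`, `j` even). -/
noncomputable def coeffA (a b α : ℝ) (j n : ℕ) : ℝ :=
  if Even n then
    if n = j then (1 / 2) * (1 - α) * a else -(1 / 4) * ((n : ℝ) - j - a)
  else -(1 / 4) * ((((n : ℝ) + 1) * ((n : ℝ) - j - b)) / ((n : ℝ) - j))

/-- The coefficient `C_n` (for `N = 2j`, `j` even). -/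
noncomputable def coeffC (a b α : ℝ) (j n : ℕ) : ℝ :=
  if Even n then
    if n = j then (1 / 2) * α * a else (1 / 4) * ((n : ℝ) - j + a)
  else (1 / 4) * ((((n : ℝ) - 2 * j - 1) * ((n : ℝ) - j + b)) / ((n : ℝ) - j))

/-- `u_0 = 0` and `u_n = A_{n-1} C_n` for `n ≥ 1`. -/
noncomputable def coeffU (a b α : ℝ) (j : ℕ) : ℕ → ℝ
  | 0 => 0
  | n + 1 => coeffA a b α j n * coeffC a b α j (n + 1)

/-- The diagonal coefficient `(b - j - 1 + a)/4 - A_n - C_n`. -/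
noncomputable def coeffDiag (a b α : ℝ) (j n : ℕ) : ℝ :=
  (b - j - 1 + a) / 4 - coeffA a b α j n - coeffC a b α j n

/-- The monic para-Bannai-Ito polynomials `P_n^{(0)}(x; a, b, α, 2j)`, given by
`x P_n = P_{n+1} + ((b-j-1+a)/4 - A_n - C_n) P_n + u_n P_{n-1}`, `P_0 = 1`, `P_{-1} = 0`. -/
noncomputable def paraP (a b α : ℝ) (j : ℕ) : ℕ → ℝ[X]
  | 0 => 1
  | 1 => X - C (coeffDiag a b α j 0)
  | n + 2 => (X - C (coeffDiag a b α j (n + 1))) * paraP a b α j (n + 1)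
      - C (coeffU a b α j (n + 1)) * paraP a b α j n

/-- The product `u_1 ⋯ u_n`. -/
noncomputable def prodU (a b α : ℝ) (j n : ℕ) : ℝ :=
  ∏ k ∈ Finset.Icc 1 n, coeffU a b α j k

/-- The Bannai-Ito bi-lattice:
`x_{2s} = -(-1)^s (2s-j-b+a)/4 - 1/4` and `x_{2s+1} = -(-1)^s (2s-j-b-a)/4 - 1/4`. -/
noncomputable def grid (a b : ℝ) (j i : ℕ) : ℝ :=
  let s : ℕ := i / 2
  if Even i then -(-1 : ℝ) ^ s * ((2 * (s : ℝ) - j - b + a) / 4) - 1 / 4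
  else -(-1 : ℝ) ^ s * ((2 * (s : ℝ) - j - b - a) / 4) - 1 / 4

/-- The value at `α = 1/2` of `h_{2j} = √(u_1 ⋯ u_{2j})`, in closed form. -/
noncomputable def hTop (a b : ℝ) (j : ℕ) : ℝ :=
  (poch 1 j * poch ((b + 1 - j) / 2) j * poch (-((j + a) / 2)) j)
    / (2 ^ (2 * j) * poch ((1 - (j : ℝ)) / 2) j)

/-- The persymmetric weights `w̃_i`, `i = 4s + r` with `r ∈ {0, 1, 2, 3}`, as Pochhammer ratios. -/
noncomputable def persymWeight (a b : ℝ) (j i : ℕ) : ℝ :=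
  let s : ℕ := i / 4
  let m : ℕ := j / 2
  let t : ℝ := (s : ℝ)
  if i % 4 = 0 then
    hTop a b j / (poch (-t) s * poch 1 (m - s) * poch (-t - a / 2) m
      * poch (t + (1 + a - b - j) / 2) m * poch (t + (1 - b - j) / 2) m)
  else if i % 4 = 1 then
    -(hTop a b j / (poch (-t) s * poch 1 (m - s - 1) * poch (-t + a / 2) (m + 1)
      * poch (t + (1 - a - b - j) / 2) m * poch (t + (1 - b - j) / 2) m))
  else if i % 4 = 2 then
    -(hTop a b j / (poch (-t) s * poch 1 (m - s - 1) * poch (-t - a / 2) m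
      * poch (t + (1 + a - b - j) / 2) (m + 1) * poch (t + (1 - b - j) / 2) m))
  else
    hTop a b j / (poch (-t) s * poch 1 (m - s - 1) * poch (-t + a / 2) m
      * poch (t + (1 - a - b - j) / 2) m * poch (t + (1 - b - j) / 2) (m + 1))

/-- The weights `w_{2s} = 2α w̃_{2s}` and `w_{2s+1} = 2(1-α) w̃_{2s+1}`. -/
noncomputable def weight (a b α : ℝ) (j i : ℕ) : ℝ :=
  if Even i then 2 * α * persymWeight a b j i else 2 * (1 - α) * persymWeight a b j i

/-- The explicit norms of even index, `h_{2n}`. -/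
noncomputable def normEven (a b α : ℝ) (j n : ℕ) : ℝ :=
  √(poch (-(j : ℝ)) n * poch 1 n * poch ((1 + b - j) / 2) n * poch ((1 - b - j) / 2) n
      * poch (-((j + a) / 2)) n * poch ((2 + a - j) / 2) n)
    / (2 ^ (2 * n) * |poch ((1 - (j : ℝ)) / 2) n|)
    * (if n < j / 2 then 1 else if n = j / 2 then √(2 * α) else 2 * √(α * (1 - α)))

/-- The explicit norms of odd index, `h_{2n+1}`. -/
noncomputable def normOdd (a b α : ℝ) (j n : ℕ) : ℝ :=
  √(((-1) * poch (-(j : ℝ)) (n + 1) * poch 1 n * poch ((1 + b - j) / 2) (n + 1)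
      * poch ((1 - b - j) / 2) n * poch (-((j + a) / 2)) (n + 1) * poch ((2 + a - j) / 2) n)
      / (poch ((1 - (j : ℝ)) / 2) n * poch ((1 - (j : ℝ)) / 2) (n + 1)))
    / 2 ^ (2 * n + 1)
    * (if n < j / 2 then 1 else 2 * √(α * (1 - α)))

end ParaBI

/-! Write `j = 2m`. The diagonal recurrence coefficients alternate between `c` and `-c`, with `c =
center a b m`, so below the middle `P_{2n} = S_n(x² - c²)` and `P_{2n+1} = (x - c) T_n(x² - c²)`.
The coefficients `u_n` there are of Wilson type, and `S_n`, `T_n` have hypergeometric expansions in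
a Newton basis on a quadratic lattice. Two parameter sets give the same `u_n` but different
lattices, one for each half of the bi-lattice. On the odd half all but the last term of `S_m`
vanish, so `P_{2m}` is zero at the odd grid points. On the even half the lower part of `S_m` is `κ
T_{m-1}`, with `κ = midCoupling a b m`, so `(x - c) P_{2m} = κ P_{2m-1}` at the even grid points.
The parameter `α` enters only through `u_{2m} = ακ` and `u_{2m+1} = (1-α)κ`; the other coefficients
are symmetric under reflection about the middle. At a grid point the recurrence above the middle
therefore retraces the one below, up to a factor `l`, equal to `-ακ` (odd) or `(1-α)κ` (even).
Reaching `u_0 = 0` gives `P_{4m+1} = 0`, and `P_{4m}` takes just two values on the grid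
(`paraP_eval_grid`). Distinctness of the points then yields the factorization. Christoffel–Darboux
at the zeros of `P_{4m+1}` gives orthogonality for `0 < α < 1`; continuity in `α` reaches the
endpoints. Since `P_{4m+1}` does not depend on `α`, the weights are `2α` or `2(1-α)` times fixed
numbers, found by evaluating `P_{4m+1}'` as a product of node differences. Norms follow by induction
at `α = 1/2`, where the middle coefficients fit the generic formula. -/

namespace ParaBI

open Polynomial

/-! ### Pochhammer symbols -/

section Pochhammer

@[simp] theorem poch_zero (x : ℝ) : poch x 0 = 1 := by simp [poch]

theorem poch_succ (x : ℝ) (k : ℕ) : poch x (k + 1) = poch x k * (x + k) := by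
  simp [poch, ascPochhammer_succ_eval]

theorem poch_eq_prod (x : ℝ) (k : ℕ) : poch x k = ∏ i ∈ Finset.range k, (x + i) := by
  induction k with
  | zero => simp
  | succ k ih => rw [poch_succ, ih, Finset.prod_range_succ]

theorem poch_succ_left (x : ℝ) (k : ℕ) : poch x (k + 1) = x * poch (x + 1) k := by
  rw [poch_eq_prod, poch_eq_prod, Finset.prod_range_succ']
  push_cast
  rw [mul_comm, add_zero]
  congr 1
  exact Finset.prod_congr rfl fun i _ => by ring

theorem poch_ne_zero {x : ℝ} {k : ℕ} (h : ∀ i < k, x + (i : ℝ) ≠ 0) : poch x k ≠ 0 := by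
  rw [poch_eq_prod]
  exact Finset.prod_ne_zero_iff.2 fun i hi => h i (Finset.mem_range.1 hi)

theorem poch_reflect (x : ℝ) (k : ℕ) : poch x k = (-1) ^ k * poch (1 - k - x) k := by
  have hs : ((-1 : ℝ)) ^ k = ∏ _i ∈ Finset.range k, (-1 : ℝ) := by simp
  rw [poch_eq_prod, poch_eq_prod, ← Finset.prod_range_reflect, hs, ← Finset.prod_mul_distrib]
  refine Finset.prod_congr rfl fun i hi => ?_
  have : i + 1 ≤ k := Finset.mem_range.1 hi
  rw [Nat.sub_sub, Nat.cast_sub (by omega)]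
  push_cast
  ring

end Pochhammer

/-! ### Contiguity relations for the Newton coefficients -/

section Split

/-- Coefficients of the even-index polynomials in the Newton basis of a quadratic lattice. -/
noncomputable def splitS (f₁ f₂ f₃ g : ℝ) (n k : ℕ) : ℝ :=
  n.choose k * (poch (k + f₁) (n - k) * poch (k + f₂) (n - k) * poch (k + f₃) (n - k))
    / poch (n + k + g) (n - k)

/-- Coefficients of the odd-index polynomials in the Newton basis of a quadratic lattice. -/
noncomputable def splitT (f₁ f₂ f₃ g : ℝ) (n k : ℕ) : ℝ := splitS (f₁ + 1) f₂ f₃ (g + 1) n k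

variable (f₁ f₂ f₃ g : ℝ)

@[simp] theorem splitS_self (n : ℕ) : splitS f₁ f₂ f₃ g n n = 1 := by simp [splitS]

theorem splitS_of_lt {n k : ℕ} (h : n < k) : splitS f₁ f₂ f₃ g n k = 0 := by
  simp [splitS, Nat.choose_eq_zero_of_lt h]

@[simp] theorem splitT_self (n : ℕ) : splitT f₁ f₂ f₃ g n n = 1 := by simp [splitT]

theorem splitT_of_lt {n k : ℕ} (h : n < k) : splitT f₁ f₂ f₃ g n k = 0 := splitS_of_lt _ _ _ _ h

variable {f₁ f₂ f₃ g}

theorem choose_succ_mul_real {n k : ℕ} (h : k ≤ n) :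
    ((n + 1).choose k : ℝ) * (n + 1 - k) = n.choose k * (n + 1) := by
  have := Nat.choose_mul_succ_eq n k
  have h2 : ((n + 1 - k : ℕ) : ℝ) = n + 1 - k := by
    rw [Nat.cast_sub (by omega)]; push_cast; ring
  rw [← h2]; exact_mod_cast this.symm

/-- Both coefficient families are hypergeometric terms, so ratios of neighbours are rational. This
relation and the next three clear denominators and reduce every coefficient to `splitT` at level
`n`. The bounded range in `hg` matters: the application has `g = -2m`, and `i + g` vanishes at `i =
2m`. -/
theorem splitS_succ {n k : ℕ} (hk : k ≤ n) (hg : ∀ i < 2 * n + 2, (i : ℝ) + g ≠ 0) :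
    splitS f₁ f₂ f₃ g (n + 1) k * ((n + 1 - k) * (2 * n + 1 + g)) =
      splitT f₁ f₂ f₃ g n k * ((n + 1) * (k + f₁) * (n + f₂) * (n + f₃)) := by
  have hc := choose_succ_mul_real hk
  obtain ⟨r, rfl⟩ := Nat.exists_eq_add_of_le hk
  have e : k + r + 1 - k = r + 1 := by omega
  have hP : poch ((k + r : ℕ) + k + (g + 1)) r ≠ 0 := poch_ne_zero fun i hi => by
    have := hg (k + r + k + 1 + i) (by omega)
    push_cast at this ⊢
    intro h; apply this; linarith
  have hl := hg (2 * (k + r) + 1) (by omega)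
  simp only [splitS, splitT, e, Nat.add_sub_cancel_left]
  rw [poch_succ_left (k + f₁), poch_succ (k + f₂), poch_succ (k + f₃), poch_succ]
  have e1 : ((k + r + 1 : ℕ) : ℝ) + k + g = ((k + r : ℕ) : ℝ) + k + (g + 1) := by push_cast; ring
  have e2 : (k : ℝ) + f₁ + 1 = k + (f₁ + 1) := by ring
  rw [e1, e2]
  push_cast at hl hc hP ⊢
  have hl' : (k : ℝ) + r + k + (g + 1) + r ≠ 0 := by
    intro h; apply hl; linarith
  rw [div_mul_eq_mul_div, div_mul_eq_mul_div, div_eq_div_iff (mul_ne_zero hP hl') hP]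
  linear_combination (poch (k + (f₁ + 1)) r * (k + f₁) * (poch (k + f₂) r * (k + f₂ + r)) *
    (poch (k + f₃) r * (k + f₃ + r)) * (2 * (k + r) + 1 + g) *
    poch ((k : ℝ) + r + k + (g + 1)) r) * hc

theorem splitT_succ {n k : ℕ} (hk : k ≤ n) (hg : ∀ i < 2 * n + 3, (i : ℝ) + g ≠ 0) :
    splitT f₁ f₂ f₃ g (n + 1) k * ((n + 1 - k) * (2 * n + 1 + g) * (2 * n + 2 + g)) =
      splitT f₁ f₂ f₃ g n k *
        ((n + 1) * (n + 1 + f₁) * (n + f₂) * (n + f₃) * (n + k + 1 + g)) := by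
  have hc := choose_succ_mul_real hk
  obtain ⟨r, rfl⟩ := Nat.exists_eq_add_of_le hk
  have e : k + r + 1 - k = r + 1 := by omega
  have hP : poch ((k + r : ℕ) + k + (g + 1)) (r + 2) ≠ 0 := poch_ne_zero fun i hi => by
    have := hg (k + r + k + 1 + i) (by omega)
    push_cast at this ⊢
    intro h; apply this; linarith
  simp only [splitS, splitT, e, Nat.add_sub_cancel_left]
  have hP1 := hP
  rw [poch_succ, poch_succ] at hP
  rw [poch_succ_left] at hP1
  -- The symbol of length `r + 2` is peeled once from the left and twice from the right, which
  -- relates the two denominators.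
  have hR : ((k + r : ℕ) + k + (g + 1)) * poch ((k + r : ℕ) + k + (g + 1) + 1) (r + 1) =
      poch ((k + r : ℕ) + k + (g + 1)) r * ((k + r : ℕ) + k + (g + 1) + r) *
        ((k + r : ℕ) + k + (g + 1) + (r + 1 : ℕ)) := by
    rw [← poch_succ_left, poch_succ, poch_succ]
  rw [poch_succ (k + (f₁ + 1)), poch_succ (k + f₂), poch_succ (k + f₃)]
  have e1 : ((k + r + 1 : ℕ) : ℝ) + k + (g + 1) = ((k + r : ℕ) : ℝ) + k + (g + 1) + 1 := by
    push_cast; ring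
  rw [e1]
  simp only [Nat.cast_add, Nat.cast_one] at hc hP hP1 hR ⊢
  have h1 := (mul_ne_zero_iff.1 (mul_ne_zero_iff.1 hP).1).1
  have h2 := (mul_ne_zero_iff.1 hP1).2
  rw [div_mul_eq_mul_div, div_mul_eq_mul_div, div_eq_div_iff h2 h1]
  set A := poch ((k : ℝ) + r + k + (g + 1)) r
  set B := poch ((k : ℝ) + r + k + (g + 1) + 1) (r + 1)
  set p₁ := poch ((k : ℝ) + (f₁ + 1)) r
  set p₂ := poch ((k : ℝ) + f₂) r
  set p₃ := poch ((k : ℝ) + f₃) r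
  rw [show (k : ℝ) + (f₁ + 1) + r = k + r + 1 + f₁ by ring,
    show (k : ℝ) + f₂ + r = k + r + f₂ by ring, show (k : ℝ) + f₃ + r = k + r + f₃ by ring,
    show 2 * ((k : ℝ) + r) + 1 + g = k + r + k + (g + 1) + r by ring,
    show 2 * ((k : ℝ) + r) + 2 + g = k + r + k + (g + 1) + (r + 1) by ring,
    show (k : ℝ) + r + k + 1 + g = k + r + k + (g + 1) by ring]
  generalize (k : ℝ) + r + k + (g + 1) + (r + 1) = x₅ at hR ⊢
  generalize (k : ℝ) + r + k + (g + 1) + r = x₄ at hR ⊢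
  generalize (k : ℝ) + r + k + (g + 1) = x₆ at hR ⊢
  generalize (k : ℝ) + r + 1 + f₁ = x₁
  generalize (k : ℝ) + r + f₂ = x₂
  generalize (k : ℝ) + r + f₃ = x₃
  linear_combination (p₁ * x₁ * (p₂ * x₂) * (p₃ * x₃) * x₄ * x₅ * A) * hc -
      ((k + r).choose k : ℝ) * (k + r + 1) * (p₁ * x₁ * (p₂ * x₂) * (p₃ * x₃)) * hR

theorem splitS_mul_eq_splitT_mul {n k : ℕ} (hk : k ≤ n) (hg : ∀ i < 2 * n + 1, (i : ℝ) + g ≠ 0) :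
    splitS f₁ f₂ f₃ g n k * ((n + f₁) * (n + k + g)) =
      splitT f₁ f₂ f₃ g n k * ((k + f₁) * (2 * n + g)) := by
  obtain ⟨r, rfl⟩ := Nat.exists_eq_add_of_le hk
  have hP : poch ((k + r : ℕ) + k + g) (r + 1) ≠ 0 := poch_ne_zero fun i hi => by
    have := hg (k + r + k + i) (by omega)
    push_cast at this ⊢
    intro h; apply this; linarith
  -- These trivial equations become exchange identities once the left side is peeled at its last
  -- factor and the right side at its first.
  have hf : poch (k + f₁) (r + 1) = poch (k + f₁) (r + 1) := rfl
  have hG : poch ((k + r : ℕ) + k + g) (r + 1) = poch ((k + r : ℕ) + k + g) (r + 1) := rfl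
  nth_rw 1 [poch_succ] at hf hG
  nth_rw 1 [poch_succ_left] at hf hG
  have hP1 := hP
  rw [poch_succ_left] at hP1
  rw [poch_succ] at hP
  have h1 := (mul_ne_zero_iff.1 hP).1
  have h2 := (mul_ne_zero_iff.1 hP1).2
  simp only [splitS, splitT, Nat.add_sub_cancel_left]
  rw [← add_assoc (k : ℝ) f₁ 1, ← add_assoc _ g 1]
  rw [div_mul_eq_mul_div, div_mul_eq_mul_div, div_eq_div_iff h1 h2]
  push_cast at *
  set A := poch ((k : ℝ) + r + k + g) r
  set B := poch ((k : ℝ) + r + k + g + 1) r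
  set p₁ := poch ((k : ℝ) + f₁) r
  set q₁ := poch ((k : ℝ) + f₁ + 1) r
  set p₂ := poch ((k : ℝ) + f₂) r
  set p₃ := poch ((k : ℝ) + f₃) r
  linear_combination (((k + r).choose k : ℝ) * p₂ * p₃) * ((k + r + k + g) * B * hf - q₁ * (k + f₁) * hG)

theorem splitT_step {n k : ℕ} (hk : k < n) (hg : ∀ i < 2 * n + 1, (i : ℝ) + g ≠ 0) :
    splitT f₁ f₂ f₃ g n k * ((n - k) * (n + (k + 1) + g)) =
      splitT f₁ f₂ f₃ g n (k + 1) * ((k + 1) * (k + 1 + f₁) * (k + f₂) * (k + f₃)) := by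
  have hc : (n.choose (k + 1) : ℝ) * (k + 1) = n.choose k * (n - k) := by
    rw [← Nat.cast_sub hk.le]; exact_mod_cast Nat.choose_succ_right_eq n k
  obtain ⟨r, rfl⟩ := Nat.exists_eq_add_of_lt hk
  have e : k + r + 1 - k = r + 1 := by omega
  have e' : k + r + 1 - (k + 1) = r := by omega
  have hP : poch ((k + r + 1 : ℕ) + k + (g + 1)) (r + 1) ≠ 0 := poch_ne_zero fun i hi => by
    have := hg (k + r + 1 + k + 1 + i) (by omega)
    push_cast at this ⊢
    intro h; apply this; linarith
  simp only [splitS, splitT, e, e']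
  rw [poch_succ_left] at hP
  have h1 := (mul_ne_zero_iff.1 hP).1
  have h2 := (mul_ne_zero_iff.1 hP).2
  rw [poch_succ_left, poch_succ_left, poch_succ_left, poch_succ_left]
  have e1 : ((k + 1 : ℕ) : ℝ) + (f₁ + 1) = k + (f₁ + 1) + 1 := by push_cast; ring
  have e2 : ((k + 1 : ℕ) : ℝ) + f₂ = k + f₂ + 1 := by push_cast; ring
  have e3 : ((k + 1 : ℕ) : ℝ) + f₃ = k + f₃ + 1 := by push_cast; ring
  have e4 : ((k + r + 1 : ℕ) : ℝ) + (k + 1 : ℕ) + (g + 1) = (k + r + 1 : ℕ) + k + (g + 1) + 1 := by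
    push_cast; ring
  rw [e1, e2, e3, e4, div_mul_eq_mul_div, div_mul_eq_mul_div, div_eq_div_iff (mul_ne_zero h1 h2) h2]
  push_cast at *
  set B := poch ((k : ℝ) + r + 1 + k + (g + 1) + 1) r
  set p₁ := poch ((k : ℝ) + (f₁ + 1) + 1) r
  set p₂ := poch ((k : ℝ) + f₂ + 1) r
  set p₃ := poch ((k : ℝ) + f₃ + 1) r
  linear_combination -(p₁ * p₂ * p₃ * B * (k + 1 + f₁) * (k + f₂) * (k + f₃) *
    (k + r + 1 + (k + 1) + g)) * hc

end Split

/-! ### Mixed recurrences for the even and odd Newton expansions -/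

section Expansion

variable (f₁ f₂ f₃ g : ℝ)

/-- The recurrence coefficient `u_{2n}` of a Wilson-type system. -/
noncomputable def wilsonC (n : ℕ) : ℝ :=
  -(n * (n + f₂ - 1) * (n + f₃ - 1) * (n + g - f₁)) / ((2 * n + g - 1) * (2 * n + g))

/-- The recurrence coefficient `u_{2n+1}` of a Wilson-type system. -/
noncomputable def wilsonA (n : ℕ) : ℝ :=
  -((n + g) * (n + f₁) * (n + g + 1 - f₃) * (n + g + 1 - f₂)) / ((2 * n + g) * (2 * n + g + 1))

/-- The nodes of the quadratic lattice. -/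
noncomputable def qnode (i : ℕ) : ℝ := (f₁ + i) * (f₂ + f₃ - g - 1 + i)

/-- The Newton basis on the quadratic lattice. -/
noncomputable def newton (z : ℝ) (k : ℕ) : ℝ := ∏ i ∈ Finset.range k, (z - qnode f₁ f₂ f₃ g i)

/-- The even-index polynomial, expanded in the Newton basis. -/
noncomputable def sumS (n : ℕ) (z : ℝ) : ℝ :=
  ∑ k ∈ Finset.range (n + 1), splitS f₁ f₂ f₃ g n k * newton f₁ f₂ f₃ g z k

/-- The odd-index polynomial, expanded in the Newton basis. -/
noncomputable def sumT (n : ℕ) (z : ℝ) : ℝ :=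
  ∑ k ∈ Finset.range (n + 1), splitT f₁ f₂ f₃ g n k * newton f₁ f₂ f₃ g z k

theorem newton_succ (z : ℝ) (k : ℕ) :
    newton f₁ f₂ f₃ g z (k + 1) = newton f₁ f₂ f₃ g z k * (z - qnode f₁ f₂ f₃ g k) := by
  simp [newton, Finset.prod_range_succ]

theorem newton_qnode {i k : ℕ} (h : i < k) :
    newton f₁ f₂ f₃ g (qnode f₁ f₂ f₃ g i) k = 0 :=
  Finset.prod_eq_zero (Finset.mem_range.2 h) (sub_self _)

variable {f₁ f₂ f₃ g}

/-- Comparison of Newton coefficients in `T_{n+1} = S_{n+1} - C_{n+1} T_n`. For `k ≤ n` the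
contiguity relations express all terms by `splitT` at level `n`; above that only leading ones or
zeros remain. -/
theorem splitT_eq_splitS_sub {n : ℕ} (k : ℕ) (hg : ∀ i < 2 * n + 3, (i : ℝ) + g ≠ 0) :
    splitT f₁ f₂ f₃ g (n + 1) k =
      splitS f₁ f₂ f₃ g (n + 1) k - wilsonC f₁ f₂ f₃ g (n + 1) * splitT f₁ f₂ f₃ g n k := by
  rcases lt_or_ge n k with h | h
  · rw [splitT_of_lt _ _ _ _ h]
    rcases Nat.eq_or_lt_of_le h with rfl | h'
    · simp
    · rw [splitT_of_lt _ _ _ _ h', splitS_of_lt _ _ _ _ h']; simp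
  · have hs := splitS_succ (f₁ := f₁) (f₂ := f₂) (f₃ := f₃) h fun i hi => hg i (by omega)
    have ht := splitT_succ (f₁ := f₁) (f₂ := f₂) (f₃ := f₃) h hg
    have d1 : (2 * n + 1 + g : ℝ) ≠ 0 := by exact_mod_cast hg (2 * n + 1) (by omega)
    have d2 : (2 * n + 2 + g : ℝ) ≠ 0 := by exact_mod_cast hg (2 * n + 2) (by omega)
    have d3 : (n + 1 - k : ℝ) ≠ 0 := by
      have : (k : ℝ) ≤ n := by exact_mod_cast h
      linarith
    have hC : wilsonC f₁ f₂ f₃ g (n + 1) * ((2 * n + 1 + g) * (2 * n + 2 + g)) =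
        -((n + 1) * (n + f₂) * (n + f₃) * (n + 1 + g - f₁)) := by
      rw [wilsonC]
      push_cast
      rw [show 2 * ((n : ℝ) + 1) + g - 1 = 2 * n + 1 + g by ring,
        show 2 * ((n : ℝ) + 1) + g = 2 * n + 2 + g by ring, div_mul_cancel₀ _ (mul_ne_zero d1 d2)]
      ring
    refine mul_right_cancel₀ (mul_ne_zero (mul_ne_zero d3 d1) d2) ?_
    linear_combination ht - (2 * n + 2 + g) * hs + splitT f₁ f₂ f₃ g n k * (n + 1 - k) * hC

theorem wilsonA_mul_splitS {n k : ℕ} (hk : k ≤ n) (hg : ∀ i < 2 * n + 2, (i : ℝ) + g ≠ 0) :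
    wilsonA f₁ f₂ f₃ g n * splitS f₁ f₂ f₃ g n k * ((2 * n + 1 + g) * (n + k + g)) =
      -((n + g) * (n + g + 1 - f₃) * (n + g + 1 - f₂) * (k + f₁)) * splitT f₁ f₂ f₃ g n k := by
  have h := splitS_mul_eq_splitT_mul (f₁ := f₁) (f₂ := f₂) (f₃ := f₃) hk
    fun i hi => hg i (by omega)
  have d0 : (2 * n + g : ℝ) ≠ 0 := by exact_mod_cast hg (2 * n) (by omega)
  have d1 : (2 * n + 1 + g : ℝ) ≠ 0 := by exact_mod_cast hg (2 * n + 1) (by omega)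
  have hA : wilsonA f₁ f₂ f₃ g n * ((2 * n + g) * (2 * n + 1 + g)) =
      -((n + g) * (n + f₁) * (n + g + 1 - f₃) * (n + g + 1 - f₂)) := by
    rw [wilsonA, show 2 * (n : ℝ) + g + 1 = 2 * n + 1 + g by ring,
      div_mul_cancel₀ _ (mul_ne_zero d0 d1)]
  refine mul_right_cancel₀ d0 ?_
  linear_combination splitS f₁ f₂ f₃ g n k * (n + k + g) * hA -
    ((n + g) * (n + g + 1 - f₃) * (n + g + 1 - f₂)) * h

theorem splitS_succ_zero {n : ℕ} (hg : ∀ i < 2 * n + 2, (i : ℝ) + g ≠ 0) :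
    splitS f₁ f₂ f₃ g (n + 1) 0 = qnode f₁ f₂ f₃ g 0 * splitT f₁ f₂ f₃ g n 0 -
      wilsonA f₁ f₂ f₃ g n * splitS f₁ f₂ f₃ g n 0 := by
  have hs := splitS_succ (f₁ := f₁) (f₂ := f₂) (f₃ := f₃) (Nat.zero_le n) hg
  have hA := wilsonA_mul_splitS (f₁ := f₁) (f₂ := f₂) (f₃ := f₃) (Nat.zero_le n) hg
  have d1 : (2 * n + 1 + g : ℝ) ≠ 0 := by exact_mod_cast hg (2 * n + 1) (by omega)
  have d2 : ((n : ℝ) + (0 : ℕ) + g : ℝ) ≠ 0 := by simpa using hg n (by omega)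
  have d3 : (n + 1 - (0 : ℕ) : ℝ) ≠ 0 := by simpa using Nat.cast_add_one_ne_zero (R := ℝ) n
  refine mul_right_cancel₀ (mul_ne_zero (mul_ne_zero d3 d1) d2) ?_
  rw [qnode]
  push_cast at *
  linear_combination (n + g) * hs + (n + 1) * hA

/-- Comparison of coefficients in `S_{n+1} = z T_n - A_n S_n`: multiplying the `k`-th Newton
polynomial by `z` gives the next one plus the `k`-th node times itself. -/
theorem splitS_succ_succ {n : ℕ} (k : ℕ) (hg : ∀ i < 2 * n + 2, (i : ℝ) + g ≠ 0) :
    splitS f₁ f₂ f₃ g (n + 1) (k + 1) = splitT f₁ f₂ f₃ g n k +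
      qnode f₁ f₂ f₃ g (k + 1) * splitT f₁ f₂ f₃ g n (k + 1) -
      wilsonA f₁ f₂ f₃ g n * splitS f₁ f₂ f₃ g n (k + 1) := by
  rcases lt_or_ge k n with h | h
  · have hs := splitS_succ (k := k + 1) (f₁ := f₁) (f₂ := f₂) (f₃ := f₃) h hg
    have hA := wilsonA_mul_splitS (k := k + 1) (f₁ := f₁) (f₂ := f₂) (f₃ := f₃) h hg
    have ht := splitT_step (f₁ := f₁) (f₂ := f₂) (f₃ := f₃) h fun i hi => hg i (by omega)
    have d1 : (2 * n + 1 + g : ℝ) ≠ 0 := by exact_mod_cast hg (2 * n + 1) (by omega)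
    have d2 : ((n : ℝ) + (k + 1) + g : ℝ) ≠ 0 := by
      have := hg (n + (k + 1)) (by omega); push_cast at this; exact this
    have d3 : (n - k : ℝ) ≠ 0 := by
      have : (k : ℝ) < n := by exact_mod_cast h
      linarith
    push_cast at hs hA
    rw [show (n : ℝ) + 1 - (k + 1) = n - k by ring] at hs
    refine mul_right_cancel₀ (mul_ne_zero (mul_ne_zero d3 d1) d2) ?_
    rw [qnode]
    push_cast
    linear_combination (n + (k + 1) + g) * hs - (2 * n + 1 + g) * ht + (n - k) * hA
  · rw [splitT_of_lt _ _ _ _ (show n < k + 1 by omega), splitS_of_lt _ _ _ _ (show n < k + 1 by omega)]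
    rcases Nat.eq_or_lt_of_le h with rfl | h'
    · simp
    · rw [splitT_of_lt _ _ _ _ h', splitS_of_lt _ _ _ _ (show n + 1 < k + 1 by omega)]; simp

theorem sumT_succ {n : ℕ} (z : ℝ) (hg : ∀ i < 2 * n + 3, (i : ℝ) + g ≠ 0) :
    sumT f₁ f₂ f₃ g (n + 1) z =
      sumS f₁ f₂ f₃ g (n + 1) z - wilsonC f₁ f₂ f₃ g (n + 1) * sumT f₁ f₂ f₃ g n z := by
  have h : sumT f₁ f₂ f₃ g n z =
      ∑ k ∈ Finset.range (n + 1 + 1), splitT f₁ f₂ f₃ g n k * newton f₁ f₂ f₃ g z k := by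
    rw [Finset.sum_range_succ, splitT_of_lt _ _ _ _ (Nat.lt_succ_self n), zero_mul, add_zero, sumT]
  rw [h, sumT, sumS, Finset.mul_sum, ← Finset.sum_sub_distrib]
  refine Finset.sum_congr rfl fun k _ => ?_
  rw [splitT_eq_splitS_sub k hg]
  ring

theorem sumS_succ {n : ℕ} (z : ℝ) (hg : ∀ i < 2 * n + 2, (i : ℝ) + g ≠ 0) :
    sumS f₁ f₂ f₃ g (n + 1) z =
      z * sumT f₁ f₂ f₃ g n z - wilsonA f₁ f₂ f₃ g n * sumS f₁ f₂ f₃ g n z := by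
  have hz : z * sumT f₁ f₂ f₃ g n z =
      ∑ k ∈ Finset.range (n + 1), splitT f₁ f₂ f₃ g n k * newton f₁ f₂ f₃ g z (k + 1) +
      ∑ k ∈ Finset.range (n + 2),
        qnode f₁ f₂ f₃ g k * splitT f₁ f₂ f₃ g n k * newton f₁ f₂ f₃ g z k := by
    rw [Finset.sum_range_succ _ (n + 1), splitT_of_lt _ _ _ _ (Nat.lt_succ_self n), mul_zero,
      zero_mul, add_zero, sumT, Finset.mul_sum, ← Finset.sum_add_distrib]
    refine Finset.sum_congr rfl fun k _ => ?_
    rw [newton_succ]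
    ring
  have hS : sumS f₁ f₂ f₃ g n z =
      ∑ k ∈ Finset.range (n + 2), splitS f₁ f₂ f₃ g n k * newton f₁ f₂ f₃ g z k := by
    rw [Finset.sum_range_succ _ (n + 1), splitS_of_lt _ _ _ _ (Nat.lt_succ_self n), zero_mul,
      add_zero, sumS]
  rw [hz, hS, sumS, Finset.sum_range_succ', Finset.sum_range_succ' _ (n + 1),
    Finset.sum_range_succ' _ (n + 1), splitS_succ_zero hg, mul_add, Finset.mul_sum]
  have : ∀ k, splitS f₁ f₂ f₃ g (n + 1) (k + 1) * newton f₁ f₂ f₃ g z (k + 1) =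
      splitT f₁ f₂ f₃ g n k * newton f₁ f₂ f₃ g z (k + 1) +
      qnode f₁ f₂ f₃ g (k + 1) * splitT f₁ f₂ f₃ g n (k + 1) * newton f₁ f₂ f₃ g z (k + 1) -
      wilsonA f₁ f₂ f₃ g n * (splitS f₁ f₂ f₃ g n (k + 1) * newton f₁ f₂ f₃ g z (k + 1)) := by
    intro k
    rw [splitS_succ_succ k hg]
    ring
  rw [Finset.sum_congr rfl fun k _ => this k, Finset.sum_sub_distrib, Finset.sum_add_distrib]
  ring

@[simp] theorem sumS_zero (z : ℝ) : sumS f₁ f₂ f₃ g 0 z = 1 := by simp [sumS, newton]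

@[simp] theorem sumT_zero (z : ℝ) : sumT f₁ f₂ f₃ g 0 z = 1 := by simp [sumT, newton]

end Expansion

/-! ### The recurrence coefficients: alternation, middle values, reflection -/

section Coefficients

variable (a b α : ℝ) (m : ℕ)

/-- The diagonal recurrence coefficients alternate between `center` and `-center`. -/
noncomputable def center (a b : ℝ) (m : ℕ) : ℝ := (b - 2 * m - 1 - a) / 4

theorem two_mul_add_one_sub_ne (n m : ℕ) : (2 * n + 1 - 2 * m : ℝ) ≠ 0 := by
  have h : (2 * n + 1 : ℤ) - 2 * m ≠ 0 := by omega
  exact_mod_cast h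

theorem coeffA_even {n : ℕ} (h : n ≠ m) :
    coeffA a b α (2 * m) (2 * n) = -(1 / 4) * (2 * n - 2 * m - a) := by
  simp [coeffA, h]

theorem coeffC_even {n : ℕ} (h : n ≠ m) :
    coeffC a b α (2 * m) (2 * n) = (1 / 4) * (2 * n - 2 * m + a) := by
  simp [coeffC, h]

theorem coeffA_mid : coeffA a b α (2 * m) (2 * m) = (1 / 2) * (1 - α) * a := by
  simp [coeffA]

theorem coeffC_mid : coeffC a b α (2 * m) (2 * m) = (1 / 2) * α * a := by
  simp [coeffC]

theorem coeffA_odd (n : ℕ) :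
    coeffA a b α (2 * m) (2 * n + 1) =
      -(1 / 4) * ((2 * n + 2) * (2 * n + 1 - 2 * m - b) / (2 * n + 1 - 2 * m)) := by
  simp [coeffA]
  ring

theorem coeffC_odd (n : ℕ) :
    coeffC a b α (2 * m) (2 * n + 1) =
      (1 / 4) * ((2 * n - 4 * m) * (2 * n + 1 - 2 * m + b) / (2 * n + 1 - 2 * m)) := by
  simp [coeffC]
  ring

/-- At the middle index `α` cancels, since `A_j + C_j = a/2` is also the generic value of `A_n +
C_n` for even `n`. -/
theorem coeffDiag_even (n : ℕ) : coeffDiag a b α (2 * m) (2 * n) = center a b m := by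
  rw [coeffDiag, center]
  by_cases h : n = m
  · subst h
    rw [coeffA_mid, coeffC_mid]; push_cast; ring
  · rw [coeffA_even _ _ _ _ h, coeffC_even _ _ _ _ h]; push_cast; ring

theorem coeffDiag_odd (n : ℕ) : coeffDiag a b α (2 * m) (2 * n + 1) = -center a b m := by
  have h := two_mul_add_one_sub_ne n m
  rw [coeffDiag, center, coeffA_odd, coeffC_odd]
  push_cast
  have e : (2 * (n : ℝ) + 2) * (2 * n + 1 - 2 * m - b) / (2 * n + 1 - 2 * m) -
      (2 * n - 4 * m) * (2 * n + 1 - 2 * m + b) / (2 * n + 1 - 2 * m) = 4 * m + 2 - 2 * b := by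
    rw [← sub_div, div_eq_iff h]; ring
  linear_combination (1 / 4) * e

theorem coeffU_even {n : ℕ} (h : n + 1 ≠ m) :
    coeffU a b α (2 * m) (2 * n + 2) =
      -((2 * n + 2) * (2 * n + 1 - 2 * m - b) * (2 * n + 2 - 2 * m + a)) /
        (16 * (2 * n + 1 - 2 * m)) := by
  have h' := two_mul_add_one_sub_ne n m
  have e := coeffC_even a b α m h
  rw [coeffU, coeffA_odd, show 2 * n + 1 + 1 = 2 * (n + 1) by ring, e, eq_div_iff (by positivity)]
  push_cast
  field_simp
  ring

theorem coeffU_odd {n : ℕ} (h : n ≠ m) :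
    coeffU a b α (2 * m) (2 * n + 1) =
      -((2 * n - 2 * m - a) * (2 * n - 4 * m) * (2 * n + 1 - 2 * m + b)) /
        (16 * (2 * n + 1 - 2 * m)) := by
  have h' := two_mul_add_one_sub_ne n m
  rw [coeffU, coeffC_odd, coeffA_even a b α m h, eq_div_iff (by positivity)]
  field_simp
  ring

/-- The coupling constant of the middle node. -/
noncomputable def midCoupling (a b : ℝ) (m : ℕ) : ℝ := -(m * (b + 1) * a) / 4

theorem coeffU_mid (hm : 0 < m) :
    coeffU a b α (2 * m) (2 * m) = α * midCoupling a b m := by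
  obtain ⟨n, rfl⟩ : ∃ n, m = n + 1 := ⟨m - 1, by omega⟩
  rw [show 2 * (n + 1) = 2 * n + 1 + 1 by ring, coeffU, show 2 * n + 1 + 1 = 2 * (n + 1) by ring,
    coeffA_odd, coeffC_mid, midCoupling]
  push_cast
  rw [show 2 * (n : ℝ) + 1 - 2 * (n + 1) = -1 by ring]
  ring

theorem coeffU_mid_succ :
    coeffU a b α (2 * m) (2 * m + 1) = (1 - α) * midCoupling a b m := by
  rw [coeffU, coeffC_odd, coeffA_mid, midCoupling,
    show 2 * (m : ℝ) + 1 - 2 * m = 1 by ring]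
  ring

theorem coeffA_reflect {n : ℕ} (hn : n ≤ 4 * m) (h : n ≠ 2 * m) :
    coeffA a b α (2 * m) (4 * m - n) = coeffC a b α (2 * m) n := by
  rcases Nat.even_or_odd' n with ⟨k, rfl | rfl⟩
  · have e : 4 * m - 2 * k = 2 * (2 * m - k) := by omega
    rw [e, coeffA_even _ _ _ _ (by omega), coeffC_even _ _ _ _ (by omega), Nat.cast_sub (by omega)]
    push_cast; ring
  · have e : 4 * m - (2 * k + 1) = 2 * (2 * m - k - 1) + 1 := by omega
    have h1 := two_mul_add_one_sub_ne k m
    rw [e, coeffA_odd, coeffC_odd, Nat.cast_sub (by omega), Nat.cast_sub (by omega)]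
    push_cast
    rw [show 2 * (2 * (m : ℝ) - k - 1) + 1 - 2 * m = -(2 * k + 1 - 2 * m) by ring, div_neg]
    field_simp
    ring

/-- The reflection `n ↦ 4m - n` exchanges `A` and `C`. The pair `u_{2m}`, `u_{2m+1}` is excluded
because it carries `α` and `1 - α`. -/
theorem coeffU_reflect {n : ℕ} (hn : n < 2 * m) (h : 1 ≤ n) :
    coeffU a b α (2 * m) (4 * m + 1 - n) = coeffU a b α (2 * m) n := by
  obtain ⟨k, rfl⟩ : ∃ k, n = k + 1 := ⟨n - 1, by omega⟩
  have e : 4 * m + 1 - (k + 1) = 4 * m - (k + 1) + 1 := by omega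
  have h1 := coeffA_reflect a b α m (n := k + 1) (by omega) (by omega)
  have h2 := coeffA_reflect a b α m (n := 4 * m - k) (by omega) (by omega)
  rw [show 4 * m - (4 * m - k) = k by omega] at h2
  rw [e, coeffU, coeffU, h1, h2, show 4 * m - (k + 1) + 1 = 4 * m - k by omega, mul_comm]

theorem coeffDiag_reflect {n : ℕ} (hn : n ≤ 4 * m) :
    coeffDiag a b α (2 * m) (4 * m - n) = coeffDiag a b α (2 * m) n := by
  rcases Nat.even_or_odd' n with ⟨k, rfl | rfl⟩
  · rw [show 4 * m - 2 * k = 2 * (2 * m - k) by omega, coeffDiag_even, coeffDiag_even]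
  · rw [show 4 * m - (2 * k + 1) = 2 * (2 * m - k - 1) + 1 by omega, coeffDiag_odd, coeffDiag_odd]

end Coefficients

/-! ### Quadratic decomposition below the middle -/

section Polynomials

variable (a b α : ℝ) (j m : ℕ)

theorem paraP_succ (n : ℕ) :
    paraP a b α j (n + 1) = (X - C (coeffDiag a b α j n)) * paraP a b α j n
      - C (coeffU a b α j n) * paraP a b α j (n - 1) := by
  cases n with
  | zero => simp [paraP, coeffU]
  | succ n => rfl

theorem paraP_eval_succ (n : ℕ) (x : ℝ) :
    (paraP a b α j (n + 1)).eval x = (x - coeffDiag a b α j n) * (paraP a b α j n).eval x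
      - coeffU a b α j n * (paraP a b α j (n - 1)).eval x := by
  simp [paraP_succ]

variable {a b α m}

/-- With diagonal entries `c` and `-c`, two recurrence steps multiply by `(x - c)(x + c)`, which
produces the variable `x² - c²` and the mixed recurrences for `sumS` and `sumT`. Only `u_n` with `n
< 2m` are used, so `α` plays no role and no denominator vanishes. -/
theorem paraP_eval_split {f₁ f₂ f₃ : ℝ} (x : ℝ)
    (hC : ∀ n, n + 1 < m → coeffU a b α (2 * m) (2 * n + 2) = wilsonC f₁ f₂ f₃ (-2 * m) (n + 1))
    (hA : ∀ n < m, coeffU a b α (2 * m) (2 * n + 1) = wilsonA f₁ f₂ f₃ (-2 * m) n)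
    {n : ℕ} (hn : n < m) :
    (paraP a b α (2 * m) (2 * n)).eval x =
        sumS f₁ f₂ f₃ (-2 * m) n (x ^ 2 - center a b m ^ 2) ∧
      (paraP a b α (2 * m) (2 * n + 1)).eval x =
        (x - center a b m) * sumT f₁ f₂ f₃ (-2 * m) n (x ^ 2 - center a b m ^ 2) ∧
      (paraP a b α (2 * m) (2 * n + 2)).eval x =
        sumS f₁ f₂ f₃ (-2 * m) (n + 1) (x ^ 2 - center a b m ^ 2) := by
  have hg : ∀ i < 2 * m, (i : ℝ) + (-2 * m) ≠ 0 := fun i hi => by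
    have : (i : ℝ) < 2 * m := by exact_mod_cast hi
    linarith
  induction n with
  | zero =>
    have h0 := coeffDiag_even a b α m 0
    have h1 := coeffDiag_odd a b α m 0
    have hS := sumS_succ (f₁ := f₁) (f₂ := f₂) (f₃ := f₃) (n := 0) (x ^ 2 - center a b m ^ 2)
      fun i hi => hg i (by omega)
    have hA0 := hA 0 hn
    simp only [mul_zero, zero_add] at h0 h1 hA0
    have e1 : (paraP a b α (2 * m) 1).eval x = x - center a b m := by simp [paraP, h0]
    refine ⟨by simp [paraP], by simpa using e1, ?_⟩
    rw [hS, paraP_eval_succ]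
    simp only [h1, e1, hA0, sumT_zero, sumS_zero]
    simp [paraP]
    ring
  | succ n ih =>
    obtain ⟨h0, h1, h2⟩ := ih (by omega)
    have e1 : (paraP a b α (2 * m) (2 * (n + 1) + 1)).eval x =
        (x - center a b m) * sumT f₁ f₂ f₃ (-2 * m) (n + 1) (x ^ 2 - center a b m ^ 2) := by
      rw [paraP_eval_succ, coeffDiag_even, sumT_succ _ fun i hi => hg i (by omega),
        show 2 * (n + 1) = 2 * n + 2 by ring, h2, hC n hn, show 2 * n + 2 - 1 = 2 * n + 1 by omega, h1]
      ring
    refine ⟨by rw [show 2 * (n + 1) = 2 * n + 2 by ring, h2], e1, ?_⟩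
    rw [paraP_eval_succ, e1, coeffDiag_odd, sumS_succ _ fun i hi => hg i (by omega),
      hA _ hn, Nat.add_sub_cancel, show 2 * (n + 1) = 2 * n + 2 by ring, h2]
    ring

end Polynomials

/-! ### Values at the middle index on the two halves of the grid -/

section HalfGrids

variable {a b α : ℝ} {m : ℕ}

theorem coeffU_eq_wilsonC_odd {n : ℕ} (hn : n + 1 < m) :
    coeffU a b α (2 * m) (2 * n + 2) =
      wilsonC (-(m + a / 2)) (-(m + (b - 1) / 2)) (1 - m) (-2 * m) (n + 1) := by
  have h' := two_mul_add_one_sub_ne n m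
  have h : (2 * n + 2 - 2 * m : ℝ) ≠ 0 := by
    have : (n : ℝ) + 1 < m := by exact_mod_cast hn
    linarith
  rw [coeffU_even _ _ _ _ hn.ne, wilsonC]
  push_cast
  rw [show 2 * ((n : ℝ) + 1) + -2 * m - 1 = 2 * n + 1 - 2 * m by ring,
    show 2 * ((n : ℝ) + 1) + -2 * m = 2 * n + 2 - 2 * m by ring,
    div_eq_div_iff (by positivity) (by positivity)]
  ring

/-- `wilsonC` and `wilsonA` are invariant under `(f₁, f₃) ↦ (g + 1 - f₃, g + 1 - f₁)`. This turns
the odd parameter set into the even one while moving the nodes from one half-lattice to the other.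
-/
theorem coeffU_eq_wilsonC_even {n : ℕ} (hn : n + 1 < m) :
    coeffU a b α (2 * m) (2 * n + 2) =
      wilsonC (-m) (-(m + (b - 1) / 2)) (1 - m + a / 2) (-2 * m) (n + 1) := by
  rw [coeffU_eq_wilsonC_odd hn, wilsonC, wilsonC]
  congr 1
  ring

theorem coeffU_eq_wilsonA_odd {n : ℕ} (hn : n < m) :
    coeffU a b α (2 * m) (2 * n + 1) =
      wilsonA (-(m + a / 2)) (-(m + (b - 1) / 2)) (1 - m) (-2 * m) n := by
  have h' := two_mul_add_one_sub_ne n m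
  have h : (2 * n - 2 * m : ℝ) ≠ 0 := by
    have : (n : ℝ) < m := by exact_mod_cast hn
    linarith
  rw [coeffU_odd _ _ _ _ hn.ne, wilsonA]
  rw [show 2 * (n : ℝ) + -2 * m + 1 = 2 * n + 1 - 2 * m by ring,
    show 2 * (n : ℝ) + -2 * m = 2 * n - 2 * m by ring,
    div_eq_div_iff (by positivity) (by positivity)]
  ring

theorem coeffU_eq_wilsonA_even {n : ℕ} (hn : n < m) :
    coeffU a b α (2 * m) (2 * n + 1) =
      wilsonA (-m) (-(m + (b - 1) / 2)) (1 - m + a / 2) (-2 * m) n := by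
  rw [coeffU_eq_wilsonA_odd hn, wilsonA, wilsonA]
  congr 1
  ring

/-- The largest point of the even half of the bi-lattice. -/
noncomputable def topEven (a b : ℝ) (m : ℕ) : ℝ := (2 * m + b - a - 1) / 4

/-- The largest point of the odd half of the bi-lattice. -/
noncomputable def topOdd (a b : ℝ) (m : ℕ) : ℝ := (2 * m + b + a - 1) / 4

/-- Here `f₃ = 1 - m` annihilates every coefficient of `S_m` below the top, leaving the Newton
polynomial through the first `m` odd nodes. -/
theorem paraP_eval_mid_of_odd {x : ℝ} {i : ℕ} (hi : i < m)
    (hx : x ^ 2 = (topOdd a b m - i) ^ 2) : (paraP a b α (2 * m) (2 * m)).eval x = 0 := by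
  obtain ⟨n, rfl⟩ : ∃ n, m = n + 1 := ⟨m - 1, by omega⟩
  have h := (paraP_eval_split (α := α) x (fun k hk => coeffU_eq_wilsonC_odd (a := a) (b := b) hk)
    (fun k hk => coeffU_eq_wilsonA_odd hk) (show n < n + 1 by omega)).2.2
  rw [show 2 * (n + 1) = 2 * n + 2 by ring] at h ⊢
  rw [h, sumS, Finset.sum_range_succ, Finset.sum_eq_zero fun k hk => ?_]
  · have hz : x ^ 2 - center a b (n + 1) ^ 2 = qnode (-((n + 1 : ℕ) + a / 2))
        (-((n + 1 : ℕ) + (b - 1) / 2)) (1 - (n + 1 : ℕ)) (-2 * (n + 1 : ℕ)) i := by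
      rw [hx, qnode, center, topOdd]; push_cast; ring
    rw [hz, newton_qnode _ _ _ _ hi, mul_zero, zero_add]
  · have hk := Finset.mem_range.1 hk
    have h0 : poch (k + (1 - (n + 1 : ℕ))) (n + 1 - k) = 0 := by
      rw [poch_eq_prod]
      refine Finset.prod_eq_zero (Finset.mem_range.2 (show n - k < n + 1 - k by omega)) ?_
      rw [Nat.cast_sub (by omega)]; push_cast; ring
    rw [splitS, h0, mul_zero, mul_zero, zero_div, zero_mul]

/-- With `f₁ = -m`, `S_m` is the top Newton polynomial plus `midCoupling` times `T_{m-1}`, and the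
top term dies at the first `m` even nodes. -/
theorem paraP_eval_mid_of_even {x : ℝ} {i : ℕ} (hi : i ≤ m) (hm : 0 < m)
    (hx : x ^ 2 = (topEven a b m - i) ^ 2) (hx' : i = m → x = center a b m) :
    (x - center a b m) * (paraP a b α (2 * m) (2 * m)).eval x =
      midCoupling a b m * (paraP a b α (2 * m) (2 * m - 1)).eval x := by
  obtain ⟨n, rfl⟩ : ∃ n, m = n + 1 := ⟨m - 1, by omega⟩
  obtain ⟨-, h1, h2⟩ := paraP_eval_split (α := α) x
    (fun k hk => coeffU_eq_wilsonC_even (a := a) (b := b) hk)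
    (fun k hk => coeffU_eq_wilsonA_even hk) (show n < n + 1 by omega)
  rw [show 2 * (n + 1) = 2 * n + 2 by ring] at h1 h2 ⊢
  rw [show 2 * n + 2 - 1 = 2 * n + 1 by omega, h1, h2]
  rcases Nat.eq_or_lt_of_le hi with rfl | hi
  -- The top Newton polynomial need not vanish at node `m`, but there `x = center`, so both sides
  -- carry the factor zero.
  · rw [hx' rfl]; ring
  have hz : x ^ 2 - center a b (n + 1) ^ 2 = qnode (-(n + 1 : ℕ))
      (-((n + 1 : ℕ) + (b - 1) / 2)) (1 - (n + 1 : ℕ) + a / 2) (-2 * (n + 1 : ℕ)) i := by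
    rw [hx, qnode, center, topEven]; push_cast; ring
  rw [hz, sumS, Finset.sum_range_succ, newton_qnode _ _ _ _ hi, mul_zero, add_zero, sumT,
    Finset.mul_sum, Finset.mul_sum, Finset.mul_sum]
  refine Finset.sum_congr rfl fun k hk => ?_
  have hk : k ≤ n := Nat.lt_succ_iff.1 (Finset.mem_range.1 hk)
  have hs := splitS_succ (f₁ := -(n + 1 : ℕ)) (f₂ := -((n + 1 : ℕ) + (b - 1) / 2))
    (f₃ := 1 - (n + 1 : ℕ) + a / 2) (g := -2 * (n + 1 : ℕ)) hk fun i hi => by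
      have : (i : ℝ) < 2 * n + 2 := by exact_mod_cast hi
      push_cast; linarith
  have hk' : (n + 1 - k : ℝ) ≠ 0 := by
    have : (k : ℝ) ≤ n := by exact_mod_cast hk
    linarith
  have : splitS (-(n + 1 : ℕ)) (-((n + 1 : ℕ) + (b - 1) / 2)) (1 - (n + 1 : ℕ) + a / 2)
      (-2 * (n + 1 : ℕ)) (n + 1) k = midCoupling a b (n + 1) *
        splitT (-(n + 1 : ℕ)) (-((n + 1 : ℕ) + (b - 1) / 2)) (1 - (n + 1 : ℕ) + a / 2)
      (-2 * (n + 1 : ℕ)) n k := by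
    -- The factor `k + f₁` in `splitS_succ` equals `-(n + 1 - k)` and cancels, so the ratio is
    -- independent of `k`.
    refine mul_right_cancel₀ hk' ?_
    rw [midCoupling]
    push_cast at hs ⊢
    linear_combination -hs
  rw [this]
  ring

end HalfGrids

/-! ### Continuing the recurrence past the middle -/

section Reflection

variable {a b α : ℝ} {m : ℕ}

theorem prodU_succ (a b α : ℝ) (j n : ℕ) :
    prodU a b α j (n + 1) = prodU a b α j n * coeffU a b α j (n + 1) := by
  rw [prodU, prodU, Finset.prod_Icc_succ_top (by omega)]

theorem prodU_eq_range (a b α : ℝ) (j n : ℕ) :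
    prodU a b α j n = ∏ i ∈ Finset.range n, coeffU a b α j (i + 1) := by
  induction n with
  | zero => simp [prodU]
  | succ n ih => rw [prodU_succ, ih, Finset.prod_range_succ]

theorem prod_coeffU_descending (a b α : ℝ) (j n : ℕ) :
    ∏ i ∈ Finset.range n, coeffU a b α j (n - i) = prodU a b α j n := by
  rw [prodU_eq_range, ← Finset.prod_range_reflect]
  refine Finset.prod_congr rfl fun i hi => ?_
  have := Finset.mem_range.1 hi
  congr 1
  omega

theorem prodU_full (hm : 0 < m) :
    prodU a b α (2 * m) (4 * m) =
      α * (1 - α) * (midCoupling a b m * prodU a b α (2 * m) (2 * m - 1)) ^ 2 := by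
  have h : 4 * m = (2 * m - 1) + 1 + 1 + (2 * m - 1) := by omega
  rw [h, prodU_eq_range, Finset.prod_range_add, ← prodU_eq_range, prodU_succ, prodU_succ,
    show 2 * m - 1 + 1 = 2 * m by omega, coeffU_mid _ _ _ _ hm, coeffU_mid_succ]
  have : ∏ i ∈ Finset.range (2 * m - 1), coeffU a b α (2 * m) (2 * m + 1 + i + 1) =
      prodU a b α (2 * m) (2 * m - 1) := by
    rw [← prod_coeffU_descending]
    refine Finset.prod_congr rfl fun i hi => ?_
    have := Finset.mem_range.1 hi
    rw [← coeffU_reflect a b α m (n := 2 * m - 1 - i) (by omega) (by omega)]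
    congr 1
    omega
  rw [this]
  ring

/-- The mirrored coefficients make the upper recurrence the lower one run backwards. `h₁` starts the
proportionality; `h₂` is what the first step across `P_{2m}` needs, and it holds either because
`P_{2m}` vanishes or because `l = u_{2m+1}`. -/
theorem paraP_eval_reflect {x l : ℝ} (hm : 0 < m)
    (h₁ : (paraP a b α (2 * m) (2 * m + 1)).eval x = l * (paraP a b α (2 * m) (2 * m - 1)).eval x)
    (h₂ : coeffU a b α (2 * m) (2 * m + 1) * (paraP a b α (2 * m) (2 * m)).eval x =
      l * (paraP a b α (2 * m) (2 * m)).eval x) (k : ℕ) (hk : k ≤ 2 * m) :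
    (paraP a b α (2 * m) (2 * m + 1 + k)).eval x =
      l * (∏ i ∈ Finset.range k, coeffU a b α (2 * m) (2 * m - 1 - i)) *
        (paraP a b α (2 * m) (2 * m - 1 - k)).eval x := by
  induction k using Nat.strong_induction_on with
  | _ k ih =>
  rcases k with _ | _ | k
  · simpa using h₁
  · have hr := coeffDiag_reflect a b α m (n := 2 * m - 1) (by omega)
    rw [show 4 * m - (2 * m - 1) = 2 * m + 1 by omega] at hr
    have hd := paraP_eval_succ a b α (2 * m) (2 * m - 1) x
    rw [show 2 * m - 1 + 1 = 2 * m by omega] at hd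
    rw [zero_add, paraP_eval_succ, Nat.add_sub_cancel, h₁, h₂, hr, hd]
    simp
    ring
  · have i1 := ih (k + 1) (by omega) (by omega)
    have i0 := ih k (by omega) (by omega)
    have hr := coeffDiag_reflect a b α m (n := 2 * m - 1 - (k + 1)) (by omega)
    rw [show 4 * m - (2 * m - 1 - (k + 1)) = 2 * m + 1 + (k + 1) by omega] at hr
    have hu := coeffU_reflect a b α m (n := 2 * m - 1 - k) (by omega) (by omega)
    rw [show 4 * m + 1 - (2 * m - 1 - k) = 2 * m + 1 + (k + 1) by omega] at hu
    have hd := paraP_eval_succ a b α (2 * m) (2 * m - 1 - (k + 1)) x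
    rw [show 2 * m - 1 - (k + 1) + 1 = 2 * m - 1 - k by omega,
      show 2 * m - 1 - (k + 1) - 1 = 2 * m - 1 - (k + 2) by omega] at hd
    rw [show 2 * m + 1 + (k + 1 + 1) = 2 * m + 1 + (k + 1) + 1 by ring, paraP_eval_succ, hr, hu,
      show 2 * m + 1 + (k + 1) - 1 = 2 * m + 1 + k by omega, i1, i0, hd,
      Finset.prod_range_succ _ (k + 1), Finset.prod_range_succ _ k]
    ring

theorem paraP_eval_full {x l : ℝ} (hm : 0 < m)
    (h₁ : (paraP a b α (2 * m) (2 * m + 1)).eval x = l * (paraP a b α (2 * m) (2 * m - 1)).eval x)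
    (h₂ : coeffU a b α (2 * m) (2 * m + 1) * (paraP a b α (2 * m) (2 * m)).eval x =
      l * (paraP a b α (2 * m) (2 * m)).eval x) :
    (paraP a b α (2 * m) (4 * m + 1)).eval x = 0 ∧
      (paraP a b α (2 * m) (4 * m)).eval x = l * prodU a b α (2 * m) (2 * m - 1) := by
  have e1 := paraP_eval_reflect hm h₁ h₂ (2 * m) le_rfl
  have e2 := paraP_eval_reflect hm h₁ h₂ (2 * m - 1) (by omega)
  rw [show 2 * m + 1 + 2 * m = 4 * m + 1 by ring] at e1
  rw [show 2 * m + 1 + (2 * m - 1) = 4 * m by omega, prod_coeffU_descending, Nat.sub_self] at e2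
  refine ⟨?_, by simpa [paraP] using e2⟩
  -- The last factor is `u_0 = 0`; hence the truncated index of the remaining polynomial value is
  -- harmless.
  have h0 : ∏ i ∈ Finset.range (2 * m), coeffU a b α (2 * m) (2 * m - 1 - i) = 0 := by
    refine Finset.prod_eq_zero (Finset.mem_range.2 (show 2 * m - 1 < 2 * m by omega)) ?_
    rw [Nat.sub_self, coeffU]
  rw [e1, h0]
  ring

theorem paraP_eval_full_odd {x : ℝ} {i : ℕ} (hi : i < m) (hx : x ^ 2 = (topOdd a b m - i) ^ 2) :
    (paraP a b α (2 * m) (4 * m + 1)).eval x = 0 ∧ (paraP a b α (2 * m) (4 * m)).eval x =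
      -α * (midCoupling a b m * prodU a b α (2 * m) (2 * m - 1)) := by
  have h := paraP_eval_mid_of_odd (α := α) hi hx
  rw [← mul_assoc]
  refine paraP_eval_full (by omega) ?_ ?_
  · rw [paraP_eval_succ, h, coeffU_mid _ _ _ _ (by omega)]
    ring
  · rw [h, mul_zero, mul_zero]

theorem paraP_eval_full_even {x : ℝ} {i : ℕ} (hi : i ≤ m) (hm : 0 < m)
    (hx : x ^ 2 = (topEven a b m - i) ^ 2) (hx' : i = m → x = center a b m) :
    (paraP a b α (2 * m) (4 * m + 1)).eval x = 0 ∧ (paraP a b α (2 * m) (4 * m)).eval x =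
      (1 - α) * (midCoupling a b m * prodU a b α (2 * m) (2 * m - 1)) := by
  have h := paraP_eval_mid_of_even (α := α) hi hm hx hx'
  rw [← mul_assoc]
  refine paraP_eval_full hm ?_ ?_
  · rw [paraP_eval_succ, coeffDiag_even, h, coeffU_mid _ _ _ _ hm]
    ring
  · rw [coeffU_mid_succ]

end Reflection

/-! ### The bi-lattice: distinct points and factorization -/

section Grid

variable (a b : ℝ) (m s : ℕ)

theorem grid_four_mul : grid a b (2 * m) (4 * s) = topEven a b m - s := by
  have h : (4 * s) / 2 = 2 * s := by omega
  have h' : Even (4 * s) := ⟨2 * s, by ring⟩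
  simp only [grid, h, h', if_true, pow_mul, topEven]
  push_cast
  ring

theorem grid_four_mul_add_one : grid a b (2 * m) (4 * s + 1) = topOdd a b m - s := by
  have h : (4 * s + 1) / 2 = 2 * s := by omega
  have h' : ¬ Even (4 * s + 1) := by rw [Nat.not_even_iff_odd]; exact ⟨2 * s, by ring⟩
  simp only [grid, h, h', if_false, pow_mul, topOdd]
  push_cast
  ring

theorem grid_four_mul_add_two : grid a b (2 * m) (4 * s + 2) = -(topEven a b m - s) := by
  have h : (4 * s + 2) / 2 = 2 * s + 1 := by omega
  have h' : Even (4 * s + 2) := ⟨2 * s + 1, by ring⟩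
  simp only [grid, h, h', if_true, pow_succ, pow_mul, topEven]
  push_cast
  ring

theorem grid_four_mul_add_three : grid a b (2 * m) (4 * s + 3) = -(topOdd a b m - s) := by
  have h : (4 * s + 3) / 2 = 2 * s + 1 := by omega
  have h' : ¬ Even (4 * s + 3) := by rw [Nat.not_even_iff_odd]; exact ⟨2 * s + 1, by ring⟩
  simp only [grid, h, h', if_false, pow_succ, pow_mul, topOdd]
  push_cast
  ring

theorem topEven_sub : topEven a b m - m = center a b m := by
  rw [topEven, center]; ring

variable {m}

theorem index_cases {i : ℕ} (hi : i ≤ 4 * m) :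
    (∃ s ≤ m, i = 4 * s) ∨ ∃ s < m, i = 4 * s + 1 ∨ i = 4 * s + 2 ∨ i = 4 * s + 3 := by
  rcases Nat.eq_zero_or_pos (i % 4) with h | h
  · exact Or.inl ⟨i / 4, by omega, by omega⟩
  · exact Or.inr ⟨i / 4, by omega, by omega⟩

variable {a b}

/-- The parameter ranges for which all recurrence coefficients `u_n` are positive. -/
def Admissible (a b : ℝ) (m : ℕ) : Prop :=
  (a < -(2 * m) ∧ |b| < 1) ∨ (2 * m - 1 < b ∧ |a + 1| < 1)

variable {s} {t : ℕ}

theorem Admissible.even_ne_neg_even (h : Admissible a b m) (hs : s ≤ m) (ht : t < m) :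
    topEven a b m - s ≠ -(topEven a b m - t) := by
  have hs' : (s : ℝ) ≤ m := by exact_mod_cast hs
  have ht' : (t : ℝ) + 1 ≤ m := by exact_mod_cast ht
  rw [topEven]
  intro e
  simp only [Admissible, abs_lt] at h
  rcases h with ⟨h, h'⟩ | ⟨h, h'⟩ <;> linarith

theorem Admissible.odd_ne_neg_odd (h : Admissible a b m) (hs : s < m) (ht : t < m) :
    topOdd a b m - s ≠ -(topOdd a b m - t) := by
  have hs' : (s : ℝ) + 1 ≤ m := by exact_mod_cast hs
  have ht' : (t : ℝ) + 1 ≤ m := by exact_mod_cast ht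
  have hs0 : (0 : ℝ) ≤ s := s.cast_nonneg
  have ht0 : (0 : ℝ) ≤ t := t.cast_nonneg
  rw [topOdd]
  intro e
  simp only [Admissible, abs_lt] at h
  rcases h with ⟨h, h'⟩ | ⟨h, h'⟩ <;> linarith

/-- The two unit-step progressions are offset by `a/2`. For `a < -2m` the even points all lie above
the odd ones; for `|a + 1| < 1` the offset lies strictly between `-1` and `0`. -/
theorem Admissible.even_ne_odd (h : Admissible a b m) (hs : s ≤ m) :
    topEven a b m - s ≠ topOdd a b m - t := by
  have hs' : (s : ℝ) ≤ m := by exact_mod_cast hs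
  have ht0 : (0 : ℝ) ≤ t := t.cast_nonneg
  rw [topEven, topOdd]
  intro e
  simp only [Admissible, abs_lt] at h
  rcases h with ⟨h, h'⟩ | ⟨h, h'⟩
  · linarith
  · rcases le_or_gt s t with hst | hst
    · have : (s : ℝ) ≤ t := by exact_mod_cast hst
      linarith
    · have : (t : ℝ) + 1 ≤ s := by exact_mod_cast hst
      linarith

/-- Equality would force `s + t = m + (b - 1)/2`. This is no integer when `|b| < 1`, and exceeds `2m
- 1` when `b > 2m - 1`. -/
theorem Admissible.even_ne_neg_odd (h : Admissible a b m) (hs : s ≤ m) (ht : t < m) :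
    topEven a b m - s ≠ -(topOdd a b m - t) := by
  have hs' : (s : ℝ) ≤ m := by exact_mod_cast hs
  have ht' : (t : ℝ) + 1 ≤ m := by exact_mod_cast ht
  rw [topEven, topOdd]
  intro e
  simp only [Admissible, abs_lt] at h
  rcases h with ⟨h, h'⟩ | ⟨h, h'⟩
  · rcases le_or_gt m (s + t) with hst | hst
    · have : (m : ℝ) ≤ s + t := by exact_mod_cast hst
      linarith
    · have : (s : ℝ) + t + 1 ≤ m := by exact_mod_cast hst
      linarith
  · linarith

theorem Admissible.grid_injOn (h : Admissible a b m) :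
    Set.InjOn (grid a b (2 * m)) (Set.Iic (4 * m)) := by
  intro i hi k hk e
  have cast_inj : ∀ {s t : ℕ} {c : ℝ}, c - s = c - t → s = t := fun {s t c} e => by
    have : (s : ℝ) = t := by linarith
    exact_mod_cast this
  rcases index_cases hi with ⟨s, hs, rfl⟩ | ⟨s, hs, rfl | rfl | rfl⟩ <;>
  rcases index_cases hk with ⟨t, ht, rfl⟩ | ⟨t, ht, rfl | rfl | rfl⟩ <;>
  simp only [grid_four_mul, grid_four_mul_add_one, grid_four_mul_add_two,
    grid_four_mul_add_three, neg_inj] at e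
  · rw [cast_inj e]
  · exact absurd e (h.even_ne_odd hs)
  · exact absurd e (h.even_ne_neg_even hs ht)
  · exact absurd e (h.even_ne_neg_odd hs ht)
  · exact absurd e.symm (h.even_ne_odd ht)
  · rw [cast_inj e]
  · exact absurd (by rw [e, neg_neg]) (h.even_ne_neg_odd ht.le hs)
  · exact absurd e (h.odd_ne_neg_odd hs ht)
  · exact absurd e.symm (h.even_ne_neg_even ht hs)
  · exact absurd (by rw [← e, neg_neg]) (h.even_ne_neg_odd hs.le ht)
  · rw [cast_inj e]
  · exact absurd e (h.even_ne_odd hs.le)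
  · exact absurd e.symm (h.even_ne_neg_odd ht hs)
  · exact absurd e.symm (h.odd_ne_neg_odd ht hs)
  · exact absurd e.symm (h.even_ne_odd ht.le)
  · rw [cast_inj e]

theorem paraP_eval_grid (α : ℝ) (hm : 0 < m) {i : ℕ} (hi : i ≤ 4 * m) :
    (paraP a b α (2 * m) (4 * m + 1)).eval (grid a b (2 * m) i) = 0 ∧
      (paraP a b α (2 * m) (4 * m)).eval (grid a b (2 * m) i) =
        (if Even i then 1 - α else -α) *
          (midCoupling a b m * prodU a b α (2 * m) (2 * m - 1)) := by
  rcases index_cases hi with ⟨s, hs, rfl⟩ | ⟨s, hs, rfl | rfl | rfl⟩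
  · rw [grid_four_mul, if_pos ⟨2 * s, by ring⟩]
    exact paraP_eval_full_even hs hm rfl fun h => by rw [h, topEven_sub]
  · rw [grid_four_mul_add_one, if_neg (by rw [Nat.not_even_iff_odd]; exact ⟨2 * s, by ring⟩)]
    exact paraP_eval_full_odd hs rfl
  · rw [grid_four_mul_add_two, if_pos ⟨2 * s + 1, by ring⟩]
    exact paraP_eval_full_even hs.le hm (neg_sq _) fun h => absurd h hs.ne
  · rw [grid_four_mul_add_three,
      if_neg (by rw [Nat.not_even_iff_odd]; exact ⟨2 * s + 1, by ring⟩)]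
    exact paraP_eval_full_odd hs (neg_sq _)

theorem paraP_monic_natDegree (a b α : ℝ) (j n : ℕ) :
    (paraP a b α j n).Monic ∧ (paraP a b α j n).natDegree = n := by
  induction n using Nat.strong_induction_on with
  | _ n ih =>
  rcases n with _ | _ | n
  · simp [paraP]
  · simp only [paraP, zero_add]
    exact ⟨monic_X_sub_C _, natDegree_X_sub_C _⟩
  · obtain ⟨m1, d1⟩ := ih (n + 1) (by omega)
    have d0 := (ih n (by omega)).2
    have hM : ((X - C (coeffDiag a b α j (n + 1))) * paraP a b α j (n + 1)).Monic :=
      (monic_X_sub_C _).mul m1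
    have hD : ((X - C (coeffDiag a b α j (n + 1))) * paraP a b α j (n + 1)).natDegree = n + 2 := by
      rw [(monic_X_sub_C _).natDegree_mul m1, natDegree_X_sub_C, d1]; ring
    have hl : (C (coeffU a b α j (n + 1)) * paraP a b α j n).natDegree <
        ((X - C (coeffDiag a b α j (n + 1))) * paraP a b α j (n + 1)).natDegree := by
      have := natDegree_C_mul_le (coeffU a b α j (n + 1)) (paraP a b α j n)
      omega
    exact ⟨hM.sub_of_left (degree_lt_degree hl),
      by rw [paraP, natDegree_sub_eq_left_of_natDegree_lt hl, hD]⟩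

theorem Admissible.paraP_eq_prod (h : Admissible a b m) (α : ℝ) (hm : 0 < m) :
    paraP a b α (2 * m) (4 * m + 1) =
      ∏ s ∈ Finset.range (4 * m + 1), (X - C (grid a b (2 * m) s)) := by
  obtain ⟨hM, hD⟩ := paraP_monic_natDegree a b α (2 * m) (4 * m + 1)
  rw [← Lagrange.nodal_eq]
  refine eq_of_degree_le_of_eval_index_eq (v := grid a b (2 * m)) (Finset.range (4 * m + 1))
    (h.grid_injOn.mono fun i hi => ?_) ?_ ?_ ?_ fun i hi => ?_
  · exact Set.mem_Iic.2 (Nat.lt_succ_iff.1 (Finset.mem_range.1 hi))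
  · rw [degree_eq_natDegree hM.ne_zero, hD, Finset.card_range]
  · rw [degree_eq_natDegree hM.ne_zero, hD, Lagrange.degree_nodal, Finset.card_range]
  · rw [hM.leadingCoeff, Lagrange.nodal_monic.leadingCoeff]
  · rw [Lagrange.eval_nodal_at_node hi]
    exact (paraP_eval_grid α hm (Nat.lt_succ_iff.1 (Finset.mem_range.1 hi))).1

end Grid

/-! ### Christoffel–Darboux and discrete orthogonality -/

section ChristoffelDarboux

variable {a b α : ℝ} {j : ℕ}

theorem christoffel_darboux (x y : ℝ) {n : ℕ} (hu : ∀ k, 1 ≤ k → k ≤ n → coeffU a b α j k ≠ 0) :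
    (x - y) * ∑ k ∈ Finset.range (n + 1),
        (paraP a b α j k).eval x * (paraP a b α j k).eval y / prodU a b α j k =
      ((paraP a b α j (n + 1)).eval x * (paraP a b α j n).eval y -
        (paraP a b α j n).eval x * (paraP a b α j (n + 1)).eval y) / prodU a b α j n := by
  induction n with
  | zero => simp [paraP, prodU]
  | succ n ih =>
    have h0 : prodU a b α j n ≠ 0 := Finset.prod_ne_zero_iff.2 fun k hk => by
      obtain ⟨h1, h2⟩ := Finset.mem_Icc.1 hk
      exact hu k h1 (by omega)
    have h1 := hu (n + 1) (by omega) le_rfl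
    rw [Finset.sum_range_succ, mul_add, ih fun k hk hk' => hu k hk (by omega), prodU_succ,
      paraP_eval_succ a b α j (n + 1) x, paraP_eval_succ a b α j (n + 1) y, Nat.add_sub_cancel]
    field_simp
    ring

theorem christoffel_darboux_diag (x : ℝ) {n : ℕ}
    (hu : ∀ k, 1 ≤ k → k ≤ n → coeffU a b α j k ≠ 0) :
    ∑ k ∈ Finset.range (n + 1),
        (paraP a b α j k).eval x * (paraP a b α j k).eval x / prodU a b α j k =
      ((paraP a b α j (n + 1)).derivative.eval x * (paraP a b α j n).eval x -
        (paraP a b α j n).derivative.eval x * (paraP a b α j (n + 1)).eval x) /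
          prodU a b α j n := by
  induction n with
  | zero => simp [paraP, prodU]
  | succ n ih =>
    have h0 : prodU a b α j n ≠ 0 := Finset.prod_ne_zero_iff.2 fun k hk => by
      obtain ⟨h1, h2⟩ := Finset.mem_Icc.1 hk
      exact hu k h1 (by omega)
    have h1 := hu (n + 1) (by omega) le_rfl
    have hd : (paraP a b α j (n + 1 + 1)).derivative.eval x = (paraP a b α j (n + 1)).eval x +
        (x - coeffDiag a b α j (n + 1)) * (paraP a b α j (n + 1)).derivative.eval x -
        coeffU a b α j (n + 1) * (paraP a b α j n).derivative.eval x := by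
      rw [paraP_succ a b α j (n + 1)]
      simp [derivative_mul]
    rw [Finset.sum_range_succ, ih fun k hk hk' => hu k hk (by omega), prodU_succ,
      hd, paraP_eval_succ a b α j (n + 1) x, Nat.add_sub_cancel]
    field_simp
    ring

/-- Orthogonality at the zeros of `P_{n+1}` for a nondegenerate three-term recurrence. -/
theorem orthogonality_of_zeros {n : ℕ} (v w : ℕ → ℝ)
    (hu : ∀ k, 1 ≤ k → k ≤ n → coeffU a b α j k ≠ 0)
    (hv : Set.InjOn v (Set.Iic n)) (hz : ∀ i ≤ n, (paraP a b α j (n + 1)).eval (v i) = 0)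
    (hw : ∀ i ≤ n, w i * ((paraP a b α j n).eval (v i) *
      (paraP a b α j (n + 1)).derivative.eval (v i)) = prodU a b α j n)
    {k l : ℕ} (hk : k ≤ n) (hl : l ≤ n) :
    ∑ s ∈ Finset.range (n + 1), w s * (paraP a b α j k).eval (v s) * (paraP a b α j l).eval (v s) =
      if k = l then prodU a b α j k else 0 := by
  have hp : ∀ i ≤ n, prodU a b α j i ≠ 0 := fun i hi => Finset.prod_ne_zero_iff.2 fun k hk => by
    obtain ⟨h1, h2⟩ := Finset.mem_Icc.1 hk
    exact hu k h1 (by omega)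
  let M : Matrix (Fin (n + 1)) (Fin (n + 1)) ℝ := fun s k => (paraP a b α j k).eval (v s)
  let D : Matrix (Fin (n + 1)) (Fin (n + 1)) ℝ :=
    fun k s => (paraP a b α j k).eval (v s) / prodU a b α j k * w s
  -- Christoffel–Darboux gives orthogonality in the dual variable: off the diagonal both boundary
  -- terms vanish at the zeros, and on it the confluent form supplies the weight.
  have h1 : M * D = 1 := by
    ext s t
    have e : (M * D) s t = (∑ k ∈ Finset.range (n + 1), (paraP a b α j k).eval (v s) *
        (paraP a b α j k).eval (v t) / prodU a b α j k) * w t := by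
      rw [Matrix.mul_apply, Finset.sum_range, Finset.sum_mul]
      refine Finset.sum_congr rfl fun k _ => ?_
      simp only [M, D]
      ring
    rw [e, Matrix.one_apply]
    have hs := Nat.lt_succ_iff.1 s.2
    have ht := Nat.lt_succ_iff.1 t.2
    split_ifs with hst
    · subst hst
      rw [christoffel_darboux_diag _ hu, hz _ hs, mul_zero, sub_zero, div_mul_eq_mul_div,
        div_eq_one_iff_eq (hp n le_rfl), ← hw _ hs]
      ring
    · have hne : v s - v t ≠ 0 := sub_ne_zero.2 fun h =>
        hst (Fin.ext (hv (Set.mem_Iic.2 hs) (Set.mem_Iic.2 ht) h))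
      have := christoffel_darboux (v s) (v t) hu
      rw [hz _ hs, hz _ ht, zero_mul, mul_zero, sub_zero, zero_div] at this
      rw [(mul_eq_zero.1 this).resolve_left hne, zero_mul]
  -- A one-sided inverse of a square matrix is two-sided; the reversed product is the orthogonality
  -- in the degrees.
  have h2 : D * M = 1 := mul_eq_one_comm.1 h1
  replace h2 : (D * M) ⟨k, by omega⟩ ⟨l, by omega⟩ =
      (1 : Matrix (Fin (n + 1)) (Fin (n + 1)) ℝ) ⟨k, by omega⟩ ⟨l, by omega⟩ := by rw [h2]
  rw [Matrix.mul_apply, Matrix.one_apply] at h2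
  simp only [M, D, Fin.mk.injEq] at h2
  have e : ∑ s ∈ Finset.range (n + 1), w s * (paraP a b α j k).eval (v s) *
      (paraP a b α j l).eval (v s) = prodU a b α j k * ∑ s : Fin (n + 1),
        (paraP a b α j k).eval (v s) / prodU a b α j k * w s * (paraP a b α j l).eval (v s) := by
    rw [Finset.sum_range, Finset.mul_sum]
    refine Finset.sum_congr rfl fun s _ => ?_
    have := hp k hk
    field_simp
  rw [e, h2]
  split_ifs <;> simp

end ChristoffelDarboux

/-! ### Node differences as Pochhammer products -/

section WeightProducts

theorem prod_add_eq_poch (c : ℝ) (n : ℕ) : ∏ t ∈ Finset.range n, (c + t) = poch c n :=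
  (poch_eq_prod c n).symm

theorem prod_sub_eq_poch (c : ℝ) (n : ℕ) :
    ∏ t ∈ Finset.range n, (c - t) = (-1) ^ n * poch (-c) n := by
  have h : ((-1 : ℝ)) ^ n = ∏ _t ∈ Finset.range n, (-1 : ℝ) := by simp
  rw [poch_eq_prod, h, ← Finset.prod_mul_distrib]
  exact Finset.prod_congr rfl fun t _ => by ring

theorem prod_skip_eq_poch {s n : ℕ} (h : s < n) :
    ∏ t ∈ Finset.range n, (if t = s then 1 else (t : ℝ) - s) =
      poch (-s) s * poch 1 (n - s - 1) := by
  obtain ⟨r, rfl⟩ := Nat.exists_eq_add_of_lt h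
  rw [Finset.prod_range_add _ (s + r) 1, Finset.prod_range_one, add_zero, add_comm s r,
    show ∀ f : ℕ → ℝ, ((∏ t ∈ Finset.range (r + s), f t) * f (r + s)) =
      (∏ t ∈ Finset.range s, f t) * f s * ∏ t ∈ Finset.range r, f (s + 1 + t) from ?_]
  · rw [if_pos rfl, mul_one, poch_eq_prod, poch_eq_prod, show r + s + 1 - s - 1 = r by omega]
    congr 1
    · refine Finset.prod_congr rfl fun t ht => ?_
      rw [if_neg (Finset.mem_range.1 ht).ne]
      ring
    · refine Finset.prod_congr rfl fun t _ => ?_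
      rw [if_neg (by omega)]
      push_cast
      ring
  · intro f
    rw [← Finset.prod_range_succ, ← Finset.prod_range_succ, ← Finset.prod_range_add,
      show s + 1 + r = r + s + 1 by ring]

theorem prod_skip_neg_eq_poch {s n : ℕ} (h : s < n) :
    ∏ t ∈ Finset.range n, (if t = s then 1 else (s : ℝ) - t) =
      (-1) ^ (n - 1) * (poch (-s) s * poch 1 (n - s - 1)) := by
  rw [← prod_skip_eq_poch h, ← Finset.mul_prod_erase _ _ (Finset.mem_range.2 h),
    ← Finset.mul_prod_erase (Finset.range n) (fun t => if t = s then 1 else (t : ℝ) - s)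
      (Finset.mem_range.2 h), if_pos rfl, one_mul, one_mul]
  have hc : ((-1 : ℝ)) ^ (n - 1) = ∏ _t ∈ (Finset.range n).erase s, (-1 : ℝ) := by
    rw [Finset.prod_const, Finset.card_erase_of_mem (Finset.mem_range.2 h), Finset.card_range]
  rw [hc, ← Finset.prod_mul_distrib]
  refine Finset.prod_congr rfl fun t ht => ?_
  rw [if_neg (Finset.ne_of_mem_erase ht), if_neg (Finset.ne_of_mem_erase ht)]
  ring

theorem prod_range_four (f : ℕ → ℝ) (m : ℕ) :
    ∏ k ∈ Finset.range (4 * m + 1), f k =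
      (∏ t ∈ Finset.range (m + 1), f (4 * t)) * (∏ t ∈ Finset.range m, f (4 * t + 1)) *
        (∏ t ∈ Finset.range m, f (4 * t + 2)) * ∏ t ∈ Finset.range m, f (4 * t + 3) := by
  induction m with
  | zero => simp
  | succ m ih =>
    rw [show 4 * (m + 1) + 1 = 4 * m + 1 + 1 + 1 + 1 + 1 by ring, Finset.prod_range_succ,
      Finset.prod_range_succ, Finset.prod_range_succ, Finset.prod_range_succ, ih,
      Finset.prod_range_succ (fun t => f (4 * t)) (m + 1),
      Finset.prod_range_succ (fun t => f (4 * t + 1)), Finset.prod_range_succ (fun t => f (4 * t + 2)),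
      Finset.prod_range_succ (fun t => f (4 * t + 3)), show 4 * (m + 1) = 4 * m + 1 + 1 + 1 + 1 by ring]
    ring

variable {a b : ℝ} {m s : ℕ}

/-- The derivative of a nodal polynomial at a node is the product of differences to the other nodes.
Splitting them by residue modulo 4 leaves four arithmetic progressions, with the vanishing factor
replaced by one. -/
theorem derivative_nodal_grid {i : ℕ} (hi : i ≤ 4 * m) :
    (∏ k ∈ Finset.range (4 * m + 1), (X - C (grid a b (2 * m) k))).derivative.eval
        (grid a b (2 * m) i) =
      (∏ t ∈ Finset.range (m + 1), if 4 * t = i then 1 else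
        grid a b (2 * m) i - (topEven a b m - t)) *
      (∏ t ∈ Finset.range m, if 4 * t + 1 = i then 1 else
        grid a b (2 * m) i - (topOdd a b m - t)) *
      (∏ t ∈ Finset.range m, if 4 * t + 2 = i then 1 else
        grid a b (2 * m) i + (topEven a b m - t)) *
      ∏ t ∈ Finset.range m, if 4 * t + 3 = i then 1 else
        grid a b (2 * m) i + (topOdd a b m - t) := by
  have hi' : i ∈ Finset.range (4 * m + 1) := Finset.mem_range.2 (by omega)
  have h := prod_range_four
    (fun k => if k = i then 1 else grid a b (2 * m) i - grid a b (2 * m) k) m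
  simp only [grid_four_mul, grid_four_mul_add_one, grid_four_mul_add_two,
    grid_four_mul_add_three, sub_neg_eq_add] at h
  rw [← Lagrange.nodal_eq, Lagrange.eval_nodal_derivative_eval_node_eq hi', Lagrange.eval_nodal,
    ← h, ← Finset.mul_prod_erase _ _ hi', if_pos rfl, one_mul]
  exact Finset.prod_congr rfl fun k hk => (if_neg (Finset.ne_of_mem_erase hk)).symm

theorem neg_one_pow_mul_self_mul (n : ℕ) (x y : ℝ) :
    (-1 : ℝ) ^ n * x * ((-1) ^ n * y) = x * y := by
  have : (-1 : ℝ) ^ n * (-1) ^ n = 1 := by rw [← mul_pow]; simp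
  linear_combination (x * y) * this

/-- For residues 2 and 3 the progression missing a factor is a sign-reversed one, so `m - 1` and `m`
signs leave an overall minus. -/
theorem neg_one_pow_pred_mul_mul (hm : 0 < m) (x y : ℝ) :
    (-1 : ℝ) ^ (m - 1) * x * ((-1) ^ m * y) = -(x * y) := by
  obtain ⟨n, rfl⟩ : ∃ n, m = n + 1 := ⟨m - 1, by omega⟩
  have : (-1 : ℝ) ^ n * (-1) ^ n = 1 := by rw [← mul_pow]; simp
  rw [Nat.add_sub_cancel, pow_succ]
  linear_combination -(x * y) * this

theorem derivative_nodal_grid_zero (hs : s ≤ m) :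
    (∏ k ∈ Finset.range (4 * m + 1), (X - C (grid a b (2 * m) k))).derivative.eval
        (grid a b (2 * m) (4 * s)) =
      poch (-s) s * poch 1 (m - s) * poch (-s - a / 2) m *
        poch (s + (1 + a - b - (2 * m : ℕ)) / 2) m * poch (s + (1 - b - (2 * m : ℕ)) / 2) m := by
  rw [derivative_nodal_grid (by omega)]
  have e0 : ∏ t ∈ Finset.range (m + 1), (if 4 * t = 4 * s then 1 else
      grid a b (2 * m) (4 * s) - (topEven a b m - t)) = poch (-s) s * poch 1 (m - s) := by
    rw [show m - s = m + 1 - s - 1 by omega, ← prod_skip_eq_poch (Nat.lt_succ_of_le hs)]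
    refine Finset.prod_congr rfl fun t _ => ?_
    rw [grid_four_mul]
    exact if_congr (by omega) rfl (by ring)
  have e1 : ∏ t ∈ Finset.range m, (if 4 * t + 1 = 4 * s then 1 else
      grid a b (2 * m) (4 * s) - (topOdd a b m - t)) = poch (-s - a / 2) m := by
    rw [← prod_add_eq_poch]
    refine Finset.prod_congr rfl fun t _ => ?_
    rw [if_neg (by omega), grid_four_mul, topEven, topOdd]; ring
  have e2 : ∏ t ∈ Finset.range m, (if 4 * t + 2 = 4 * s then 1 else
      grid a b (2 * m) (4 * s) + (topEven a b m - t)) =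
        (-1) ^ m * poch (s + (1 + a - b - (2 * m : ℕ)) / 2) m := by
    rw [show (s + (1 + a - b - (2 * m : ℕ)) / 2 : ℝ) = -(-(s + (1 + a - b - (2 * m : ℕ)) / 2)) by ring,
      ← prod_sub_eq_poch]
    refine Finset.prod_congr rfl fun t _ => ?_
    rw [if_neg (by omega), grid_four_mul, topEven]; push_cast; ring
  have e3 : ∏ t ∈ Finset.range m, (if 4 * t + 3 = 4 * s then 1 else
      grid a b (2 * m) (4 * s) + (topOdd a b m - t)) =
        (-1) ^ m * poch (s + (1 - b - (2 * m : ℕ)) / 2) m := by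
    rw [show (s + (1 - b - (2 * m : ℕ)) / 2 : ℝ) = -(-(s + (1 - b - (2 * m : ℕ)) / 2)) by ring,
      ← prod_sub_eq_poch]
    refine Finset.prod_congr rfl fun t _ => ?_
    rw [if_neg (by omega), grid_four_mul, topEven, topOdd]; push_cast; ring
  rw [e0, e1, e2, e3, mul_assoc _ ((-1) ^ m * _), neg_one_pow_mul_self_mul]
  ring

theorem derivative_nodal_grid_one (hs : s < m) :
    (∏ k ∈ Finset.range (4 * m + 1), (X - C (grid a b (2 * m) k))).derivative.eval
        (grid a b (2 * m) (4 * s + 1)) =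
      poch (-s) s * poch 1 (m - s - 1) * poch (-s + a / 2) (m + 1) *
        poch (s + (1 - a - b - (2 * m : ℕ)) / 2) m * poch (s + (1 - b - (2 * m : ℕ)) / 2) m := by
  rw [derivative_nodal_grid (by omega)]
  have e0 : ∏ t ∈ Finset.range (m + 1), (if 4 * t = 4 * s + 1 then 1 else
      grid a b (2 * m) (4 * s + 1) - (topEven a b m - t)) = poch (-s + a / 2) (m + 1) := by
    rw [← prod_add_eq_poch]
    refine Finset.prod_congr rfl fun t _ => ?_
    rw [if_neg (by omega), grid_four_mul_add_one, topEven, topOdd]; ring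
  have e1 : ∏ t ∈ Finset.range m, (if 4 * t + 1 = 4 * s + 1 then 1 else
      grid a b (2 * m) (4 * s + 1) - (topOdd a b m - t)) = poch (-s) s * poch 1 (m - s - 1) := by
    rw [← prod_skip_eq_poch hs]
    refine Finset.prod_congr rfl fun t _ => ?_
    rw [grid_four_mul_add_one]
    exact if_congr (by omega) rfl (by ring)
  have e2 : ∏ t ∈ Finset.range m, (if 4 * t + 2 = 4 * s + 1 then 1 else
      grid a b (2 * m) (4 * s + 1) + (topEven a b m - t)) =
        (-1) ^ m * poch (s + (1 - b - (2 * m : ℕ)) / 2) m := by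
    rw [show (s + (1 - b - (2 * m : ℕ)) / 2 : ℝ) = -(-(s + (1 - b - (2 * m : ℕ)) / 2)) by ring,
      ← prod_sub_eq_poch]
    refine Finset.prod_congr rfl fun t _ => ?_
    rw [if_neg (by omega), grid_four_mul_add_one, topEven, topOdd]; push_cast; ring
  have e3 : ∏ t ∈ Finset.range m, (if 4 * t + 3 = 4 * s + 1 then 1 else
      grid a b (2 * m) (4 * s + 1) + (topOdd a b m - t)) =
        (-1) ^ m * poch (s + (1 - a - b - (2 * m : ℕ)) / 2) m := by
    rw [show (s + (1 - a - b - (2 * m : ℕ)) / 2 : ℝ) = -(-(s + (1 - a - b - (2 * m : ℕ)) / 2)) by ring,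
      ← prod_sub_eq_poch]
    refine Finset.prod_congr rfl fun t _ => ?_
    rw [if_neg (by omega), grid_four_mul_add_one, topOdd]; push_cast; ring
  rw [e0, e1, e2, e3, mul_assoc _ ((-1) ^ m * _), neg_one_pow_mul_self_mul]
  ring

theorem derivative_nodal_grid_two (hs : s < m) :
    (∏ k ∈ Finset.range (4 * m + 1), (X - C (grid a b (2 * m) k))).derivative.eval
        (grid a b (2 * m) (4 * s + 2)) =
      -(poch (-s) s * poch 1 (m - s - 1) * poch (-s - a / 2) m *
        poch (s + (1 + a - b - (2 * m : ℕ)) / 2) (m + 1) *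
        poch (s + (1 - b - (2 * m : ℕ)) / 2) m) := by
  rw [derivative_nodal_grid (by omega)]
  have e0 : ∏ t ∈ Finset.range (m + 1), (if 4 * t = 4 * s + 2 then 1 else
      grid a b (2 * m) (4 * s + 2) - (topEven a b m - t)) =
        poch (s + (1 + a - b - (2 * m : ℕ)) / 2) (m + 1) := by
    rw [← prod_add_eq_poch]
    refine Finset.prod_congr rfl fun t _ => ?_
    rw [if_neg (by omega), grid_four_mul_add_two, topEven]; push_cast; ring
  have e1 : ∏ t ∈ Finset.range m, (if 4 * t + 1 = 4 * s + 2 then 1 else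
      grid a b (2 * m) (4 * s + 2) - (topOdd a b m - t)) =
        poch (s + (1 - b - (2 * m : ℕ)) / 2) m := by
    rw [← prod_add_eq_poch]
    refine Finset.prod_congr rfl fun t _ => ?_
    rw [if_neg (by omega), grid_four_mul_add_two, topEven, topOdd]; push_cast; ring
  have e2 : ∏ t ∈ Finset.range m, (if 4 * t + 2 = 4 * s + 2 then 1 else
      grid a b (2 * m) (4 * s + 2) + (topEven a b m - t)) =
        (-1) ^ (m - 1) * (poch (-s) s * poch 1 (m - s - 1)) := by
    rw [← prod_skip_neg_eq_poch hs]
    refine Finset.prod_congr rfl fun t _ => ?_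
    rw [grid_four_mul_add_two]
    exact if_congr (by omega) rfl (by ring)
  have e3 : ∏ t ∈ Finset.range m, (if 4 * t + 3 = 4 * s + 2 then 1 else
      grid a b (2 * m) (4 * s + 2) + (topOdd a b m - t)) = (-1) ^ m * poch (-s - a / 2) m := by
    rw [show (-s - a / 2 : ℝ) = -(s + a / 2) by ring, ← prod_sub_eq_poch]
    refine Finset.prod_congr rfl fun t _ => ?_
    rw [if_neg (by omega), grid_four_mul_add_two, topEven, topOdd]; ring
  rw [e0, e1, e2, e3, mul_assoc _ ((-1) ^ (m - 1) * _), neg_one_pow_pred_mul_mul (by omega)]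
  ring

theorem derivative_nodal_grid_three (hs : s < m) :
    (∏ k ∈ Finset.range (4 * m + 1), (X - C (grid a b (2 * m) k))).derivative.eval
        (grid a b (2 * m) (4 * s + 3)) =
      -(poch (-s) s * poch 1 (m - s - 1) * poch (-s + a / 2) m *
        poch (s + (1 - a - b - (2 * m : ℕ)) / 2) m *
        poch (s + (1 - b - (2 * m : ℕ)) / 2) (m + 1)) := by
  rw [derivative_nodal_grid (by omega)]
  have e0 : ∏ t ∈ Finset.range (m + 1), (if 4 * t = 4 * s + 3 then 1 else
      grid a b (2 * m) (4 * s + 3) - (topEven a b m - t)) =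
        poch (s + (1 - b - (2 * m : ℕ)) / 2) (m + 1) := by
    rw [← prod_add_eq_poch]
    refine Finset.prod_congr rfl fun t _ => ?_
    rw [if_neg (by omega), grid_four_mul_add_three, topEven, topOdd]; push_cast; ring
  have e1 : ∏ t ∈ Finset.range m, (if 4 * t + 1 = 4 * s + 3 then 1 else
      grid a b (2 * m) (4 * s + 3) - (topOdd a b m - t)) =
        poch (s + (1 - a - b - (2 * m : ℕ)) / 2) m := by
    rw [← prod_add_eq_poch]
    refine Finset.prod_congr rfl fun t _ => ?_
    rw [if_neg (by omega), grid_four_mul_add_three, topOdd]; push_cast; ring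
  have e2 : ∏ t ∈ Finset.range m, (if 4 * t + 2 = 4 * s + 3 then 1 else
      grid a b (2 * m) (4 * s + 3) + (topEven a b m - t)) = (-1) ^ m * poch (-s + a / 2) m := by
    rw [show (-s + a / 2 : ℝ) = -(s - a / 2) by ring, ← prod_sub_eq_poch]
    refine Finset.prod_congr rfl fun t _ => ?_
    rw [if_neg (by omega), grid_four_mul_add_three, topEven, topOdd]; ring
  have e3 : ∏ t ∈ Finset.range m, (if 4 * t + 3 = 4 * s + 3 then 1 else
      grid a b (2 * m) (4 * s + 3) + (topOdd a b m - t)) =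
        (-1) ^ (m - 1) * (poch (-s) s * poch 1 (m - s - 1)) := by
    rw [← prod_skip_neg_eq_poch hs]
    refine Finset.prod_congr rfl fun t _ => ?_
    rw [grid_four_mul_add_three]
    exact if_congr (by omega) rfl (by ring)
  rw [e0, e1, e2, e3, mul_assoc _ ((-1) ^ m * _), mul_comm ((-1) ^ m * _),
    neg_one_pow_pred_mul_mul (by omega)]
  ring

theorem persymWeight_eq {i : ℕ} (hi : i ≤ 4 * m) :
    persymWeight a b (2 * m) i = (-1) ^ i * hTop a b (2 * m) /
      (∏ k ∈ Finset.range (4 * m + 1), (X - C (grid a b (2 * m) k))).derivative.eval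
        (grid a b (2 * m) i) := by
  have e : (2 * m) / 2 = m := by omega
  rcases index_cases hi with ⟨s, hs, rfl⟩ | ⟨s, hs, rfl | rfl | rfl⟩
  · have h1 : (4 * s) / 4 = s := by omega
    have h2 : (4 * s) % 4 = 0 := by omega
    rw [derivative_nodal_grid_zero hs, (show Even (4 * s) from ⟨2 * s, by ring⟩).neg_one_pow, one_mul]
    simp only [persymWeight, h1, h2, e, if_true]
  · have h1 : (4 * s + 1) / 4 = s := by omega
    have h2 : (4 * s + 1) % 4 = 1 := by omega
    rw [derivative_nodal_grid_one hs, (show Odd (4 * s + 1) from ⟨2 * s, by ring⟩).neg_one_pow,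
      neg_one_mul, neg_div]
    simp only [persymWeight, h1, h2, e, if_true, one_ne_zero, if_false]
  · have h1 : (4 * s + 2) / 4 = s := by omega
    have h2 : (4 * s + 2) % 4 = 2 := by omega
    rw [derivative_nodal_grid_two hs, (show Even (4 * s + 2) from ⟨2 * s + 1, by ring⟩).neg_one_pow,
      one_mul, div_neg]
    simp [persymWeight, h1, h2, e]
  · have h1 : (4 * s + 3) / 4 = s := by omega
    have h2 : (4 * s + 3) % 4 = 3 := by omega
    rw [derivative_nodal_grid_three hs, (show Odd (4 * s + 3) from ⟨2 * s + 1, by ring⟩).neg_one_pow,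
      neg_one_mul, neg_div_neg_eq]
    simp [persymWeight, h1, h2, e]

end WeightProducts

/-! ### Comparison with `α = 1/2` and positivity -/

section HalfCoefficients

variable (a b : ℝ) (m n : ℕ)

theorem coeffA_half_even : coeffA a b (1 / 2) (2 * m) (2 * n) = -(1 / 4) * (2 * n - 2 * m - a) := by
  by_cases h : n = m
  · subst h; rw [coeffA_mid]; ring
  · exact coeffA_even _ _ _ _ h

theorem coeffC_half_even : coeffC a b (1 / 2) (2 * m) (2 * n) = (1 / 4) * (2 * n - 2 * m + a) := by
  by_cases h : n = m
  · subst h; rw [coeffC_mid]; ring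
  · exact coeffC_even _ _ _ _ h

theorem coeffU_half_even :
    coeffU a b (1 / 2) (2 * m) (2 * n + 2) =
      -((2 * n + 2) * (2 * n + 1 - 2 * m - b) * (2 * n + 2 - 2 * m + a)) /
        (16 * (2 * n + 1 - 2 * m)) := by
  have h' := two_mul_add_one_sub_ne n m
  have e := coeffC_half_even a b m (n + 1)
  rw [coeffU, coeffA_odd, show 2 * n + 1 + 1 = 2 * (n + 1) by ring, e, eq_div_iff (by positivity)]
  push_cast
  field_simp
  ring

theorem coeffU_half_odd :
    coeffU a b (1 / 2) (2 * m) (2 * n + 1) =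
      -((2 * n - 2 * m - a) * (2 * n - 4 * m) * (2 * n + 1 - 2 * m + b)) /
        (16 * (2 * n + 1 - 2 * m)) := by
  have h' := two_mul_add_one_sub_ne n m
  rw [coeffU, coeffC_odd, coeffA_half_even a b m, eq_div_iff (by positivity)]
  field_simp
  ring

variable {a b m n}

theorem coeffU_eq_half (α : ℝ) (h : n ≠ 2 * m) (h' : n ≠ 2 * m + 1) :
    coeffU a b α (2 * m) n = coeffU a b (1 / 2) (2 * m) n := by
  rcases n with _ | n
  · rfl
  rw [coeffU, coeffU]
  simp only [coeffA, coeffC, if_neg h, if_neg (show n ≠ 2 * m by omega)]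

theorem coeffU_mid_eq_half (α : ℝ) (hm : 0 < m) :
    coeffU a b α (2 * m) (2 * m) = 2 * α * coeffU a b (1 / 2) (2 * m) (2 * m) := by
  rw [coeffU_mid _ _ _ _ hm, coeffU_mid _ _ _ _ hm]; ring

theorem coeffU_mid_succ_eq_half (α : ℝ) :
    coeffU a b α (2 * m) (2 * m + 1) =
      2 * (1 - α) * coeffU a b (1 / 2) (2 * m) (2 * m + 1) := by
  rw [coeffU_mid_succ, coeffU_mid_succ]; ring

theorem prodU_eq_half (a b α : ℝ) (hm : 0 < m) (n : ℕ) :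
    prodU a b α (2 * m) n = prodU a b (1 / 2) (2 * m) n *
      (if n < 2 * m then 1 else if n = 2 * m then 2 * α else 4 * (α * (1 - α))) := by
  induction n with
  | zero => rw [if_pos (by omega)]; simp [prodU]
  | succ n ih =>
    rw [prodU_succ, prodU_succ, ih]
    rcases lt_trichotomy (n + 1) (2 * m) with h | h | h
    · rw [coeffU_eq_half α (by omega) (by omega), if_pos h, if_pos (by omega)]; ring
    · rw [h, coeffU_mid_eq_half α hm, if_pos (by omega), if_neg (by omega), if_pos rfl]; ring
    · rcases Nat.eq_or_lt_of_le (Nat.lt_succ_iff.1 h) with h2 | h2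
      · rw [← h2, coeffU_mid_succ_eq_half α, if_neg (by omega), if_pos rfl, if_neg (by omega),
          if_neg (by omega)]; ring
      · rw [coeffU_eq_half α (by omega) (by omega), if_neg (by omega), if_neg (by omega),
          if_neg (by omega), if_neg (by omega)]; ring

/-- The denominator changes sign at the middle. In each parameter regime exactly one of the two
factors involving `a` and `b` changes sign with it. -/
theorem Admissible.coeffU_half_pos (h : Admissible a b m) (hn : 1 ≤ n) (hn' : n ≤ 4 * m) :
    0 < coeffU a b (1 / 2) (2 * m) n := by
  simp only [Admissible, abs_lt] at h
  rcases Nat.even_or_odd' n with ⟨k, rfl | rfl⟩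
  · obtain ⟨i, rfl⟩ : ∃ i, k = i + 1 := ⟨k - 1, by omega⟩
    have hi0 : (0 : ℝ) ≤ i := i.cast_nonneg
    have hi1 : (i : ℝ) + 1 ≤ 2 * m := by exact_mod_cast (by omega : i + 1 ≤ 2 * m)
    rw [show 2 * (i + 1) = 2 * i + 2 by ring, coeffU_half_even]
    rcases Nat.lt_or_ge i m with him | him
    · have h1 : (i : ℝ) + 1 ≤ m := by exact_mod_cast him
      have d : (2 * i + 1 - 2 * m : ℝ) < 0 := by linarith
      have e1 : (2 * i + 1 - 2 * m - b : ℝ) < 0 := by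
        rcases h with ⟨h, h'⟩ | ⟨h, h'⟩ <;> linarith
      have e2 : (2 * i + 2 - 2 * m + a : ℝ) < 0 := by
        rcases h with ⟨h, h'⟩ | ⟨h, h'⟩ <;> linarith
      refine div_pos_of_neg_of_neg ?_ (by linarith)
      rw [neg_neg_iff_pos, mul_assoc]
      exact mul_pos (by linarith) (mul_pos_of_neg_of_neg e1 e2)
    · have h1 : (m : ℝ) ≤ i := by exact_mod_cast him
      refine div_pos ?_ (by linarith)
      rw [mul_assoc, neg_pos]
      refine mul_neg_of_pos_of_neg (by linarith) ?_
      rcases h with ⟨h, h'⟩ | ⟨h, h'⟩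
      · exact mul_neg_of_pos_of_neg (by linarith) (by linarith)
      · exact mul_neg_of_neg_of_pos (by linarith) (by linarith)
  · have hk0 : (0 : ℝ) ≤ k := k.cast_nonneg
    have hk1 : (k : ℝ) + 1 ≤ 2 * m := by exact_mod_cast (by omega : k + 1 ≤ 2 * m)
    rw [coeffU_half_odd, mul_right_comm]
    rcases Nat.lt_or_ge k m with hkm | hkm
    · have h1 : (k : ℝ) + 1 ≤ m := by exact_mod_cast hkm
      refine div_pos_of_neg_of_neg ?_ (by linarith)
      rw [neg_neg_iff_pos]
      refine mul_pos_of_neg_of_neg ?_ (by linarith)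
      rcases h with ⟨h, h'⟩ | ⟨h, h'⟩
      · exact mul_neg_of_pos_of_neg (by linarith) (by linarith)
      · exact mul_neg_of_neg_of_pos (by linarith) (by linarith)
    · have h1 : (m : ℝ) ≤ k := by exact_mod_cast hkm
      refine div_pos ?_ (by linarith)
      rw [neg_pos]
      refine mul_neg_of_pos_of_neg ?_ (by linarith)
      rcases h with ⟨h, h'⟩ | ⟨h, h'⟩
      · exact mul_pos (by linarith) (by linarith)
      · exact mul_pos (by linarith) (by linarith)

theorem Admissible.prodU_half_pos (h : Admissible a b m) (hn : n ≤ 4 * m) :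
    0 < prodU a b (1 / 2) (2 * m) n :=
  Finset.prod_pos fun k hk => by
    obtain ⟨h1, h2⟩ := Finset.mem_Icc.1 hk
    exact h.coeffU_half_pos h1 (by omega)

theorem Admissible.coeffU_ne_zero (h : Admissible a b m) {α : ℝ} (hm : 0 < m) (h0 : 0 < α)
    (h1 : α < 1) (hn : 1 ≤ n) (hn' : n ≤ 4 * m) : coeffU a b α (2 * m) n ≠ 0 := by
  have hp := (h.coeffU_half_pos hn hn').ne'
  by_cases e : n = 2 * m
  · subst e
    rw [coeffU_mid_eq_half α hm]
    positivity
  by_cases e' : n = 2 * m + 1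
  · subst e'
    rw [coeffU_mid_succ_eq_half α]
    have : 1 - α ≠ 0 := by linarith
    positivity
  · rwa [coeffU_eq_half α e e']

end HalfCoefficients

/-! ### Closed forms for the norms -/

section Norms

variable (a b : ℝ) (m n : ℕ)

/-- The radicand of the norms of even index. -/
noncomputable def evenRadicand : ℝ :=
  poch (-((2 * m : ℕ) : ℝ)) n * poch 1 n * poch ((1 + b - (2 * m : ℕ)) / 2) n *
    poch ((1 - b - (2 * m : ℕ)) / 2) n * poch (-(((2 * m : ℕ) + a) / 2)) n *
    poch ((2 + a - (2 * m : ℕ)) / 2) n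

/-- The radicand of the norms of odd index. -/
noncomputable def oddRadicand : ℝ :=
  ((-1) * poch (-((2 * m : ℕ) : ℝ)) (n + 1) * poch 1 n * poch ((1 + b - (2 * m : ℕ)) / 2) (n + 1) *
    poch ((1 - b - (2 * m : ℕ)) / 2) n * poch (-(((2 * m : ℕ) + a) / 2)) (n + 1) *
    poch ((2 + a - (2 * m : ℕ)) / 2) n) /
    (poch ((1 - ((2 * m : ℕ) : ℝ)) / 2) n * poch ((1 - ((2 * m : ℕ) : ℝ)) / 2) (n + 1))

theorem half_odd_add_ne_zero (i : ℕ) : (1 - ((2 * m : ℕ) : ℝ)) / 2 + i ≠ 0 := by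
  have := two_mul_add_one_sub_ne i m
  push_cast
  intro h
  apply this
  linarith

theorem poch_half_odd_ne_zero : poch ((1 - ((2 * m : ℕ) : ℝ)) / 2) n ≠ 0 :=
  poch_ne_zero fun i _ => half_odd_add_ne_zero m i

theorem prodU_half_odd_step
    (h : prodU a b (1 / 2) (2 * m) (2 * n) * (2 ^ (2 * n) * poch ((1 - ((2 * m : ℕ) : ℝ)) / 2) n) ^ 2 =
      evenRadicand a b m n) :
    prodU a b (1 / 2) (2 * m) (2 * n + 1) * (2 ^ (2 * n + 1)) ^ 2 = oddRadicand a b m n := by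
  have hd := two_mul_add_one_sub_ne n m
  have hp := poch_half_odd_ne_zero m n
  have hq := half_odd_add_ne_zero m n
  rw [oddRadicand, prodU_succ, coeffU_half_odd]
  simp only [poch_succ]
  rw [evenRadicand] at h
  have e : (1 - ((2 * m : ℕ) : ℝ)) / 2 + n = (2 * n + 1 - 2 * m) / 2 := by push_cast; ring
  rw [e] at hq ⊢
  rw [mul_div_assoc', div_mul_eq_mul_div, div_eq_div_iff (by positivity) (by positivity)]
  push_cast at *
  rw [pow_succ]
  linear_combination (-2 * ((2 * n - 2 * m - a) * (2 * n - 4 * m) * (2 * n + 1 - 2 * m + b)) *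
    (2 * n + 1 - 2 * m)) * h

theorem prodU_half_even_step
    (h : prodU a b (1 / 2) (2 * m) (2 * n + 1) * (2 ^ (2 * n + 1)) ^ 2 = oddRadicand a b m n) :
    prodU a b (1 / 2) (2 * m) (2 * (n + 1)) *
        (2 ^ (2 * (n + 1)) * poch ((1 - ((2 * m : ℕ) : ℝ)) / 2) (n + 1)) ^ 2 =
      evenRadicand a b m (n + 1) := by
  have hd := two_mul_add_one_sub_ne n m
  have hp := poch_half_odd_ne_zero m n
  have hq := half_odd_add_ne_zero m n
  rw [show 2 * (n + 1) = 2 * n + 1 + 1 by ring, evenRadicand, prodU_succ,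
    show 2 * n + 1 + 1 = 2 * n + 2 by ring, coeffU_half_even]
  rw [oddRadicand] at h
  simp only [poch_succ] at h ⊢
  have e : (1 - ((2 * m : ℕ) : ℝ)) / 2 + n = (2 * n + 1 - 2 * m) / 2 := by push_cast; ring
  rw [e] at hq h ⊢
  rw [eq_div_iff (by positivity)] at h
  rw [mul_div_assoc', div_mul_eq_mul_div, div_eq_iff (by positivity)]
  push_cast at *
  rw [show (2 : ℝ) ^ (2 * n + 2) = 2 ^ (2 * n + 1) * 2 by rw [← pow_succ]]
  linear_combination (-2 * (2 * n + 1 - 2 * m) * ((2 * n + 2) * (2 * n + 1 - 2 * m - b) *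
    (2 * n + 2 - 2 * m + a))) * h

theorem prodU_half_eq_evenRadicand :
    prodU a b (1 / 2) (2 * m) (2 * n) * (2 ^ (2 * n) * poch ((1 - ((2 * m : ℕ) : ℝ)) / 2) n) ^ 2 =
      evenRadicand a b m n := by
  induction n with
  | zero => simp [prodU, evenRadicand]
  | succ n ih => exact prodU_half_even_step a b m n (prodU_half_odd_step a b m n ih)

theorem prodU_half_eq_oddRadicand :
    prodU a b (1 / 2) (2 * m) (2 * n + 1) * (2 ^ (2 * n + 1)) ^ 2 = oddRadicand a b m n :=
  prodU_half_odd_step a b m n (prodU_half_eq_evenRadicand a b m n)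

variable {a b m n}

theorem Admissible.prodU_eq_normEven_sq (h : Admissible a b m) (hm : 0 < m) {α : ℝ} (h0 : 0 ≤ α)
    (h1 : α ≤ 1) (hn : n ≤ 2 * m) :
    prodU a b α (2 * m) (2 * n) = normEven a b α (2 * m) n ^ 2 := by
  have hp := poch_half_odd_ne_zero m n
  have hE := prodU_half_eq_evenRadicand a b m n
  have hR : 0 ≤ evenRadicand a b m n := by
    rw [← hE]
    exact mul_nonneg (h.prodU_half_pos (by omega)).le (sq_nonneg _)
  have hα : 0 ≤ α * (1 - α) := mul_nonneg h0 (by linarith)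
  rw [prodU_eq_half a b α hm, normEven, ← evenRadicand, mul_pow, div_pow, Real.sq_sqrt hR, ← hE,
    mul_pow _ |_|, sq_abs, ← mul_pow, mul_div_cancel_right₀ _ (by positivity)]
  congr 1
  rw [show 2 * m / 2 = m by omega]
  rcases lt_trichotomy n m with hnm | hnm | hnm
  · rw [if_pos (by omega), if_pos hnm, one_pow]
  · subst hnm
    rw [if_neg (lt_irrefl _), if_pos rfl, if_neg (lt_irrefl _), if_pos rfl,
      Real.sq_sqrt (by linarith)]
  · rw [if_neg (by omega), if_neg (by omega), if_neg (by omega), if_neg (by omega), mul_pow,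
      Real.sq_sqrt hα]
    norm_num

theorem Admissible.prodU_eq_normOdd_sq (h : Admissible a b m) (hm : 0 < m) {α : ℝ} (h0 : 0 ≤ α)
    (h1 : α ≤ 1) (hn : n < 2 * m) :
    prodU a b α (2 * m) (2 * n + 1) = normOdd a b α (2 * m) n ^ 2 := by
  have hE := prodU_half_eq_oddRadicand a b m n
  have hR : 0 ≤ oddRadicand a b m n := by
    rw [← hE]
    exact mul_nonneg (h.prodU_half_pos (by omega)).le (sq_nonneg _)
  have hα : 0 ≤ α * (1 - α) := mul_nonneg h0 (by linarith)
  rw [prodU_eq_half a b α hm, normOdd, ← oddRadicand, mul_pow, div_pow, Real.sq_sqrt hR, ← hE,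
    mul_div_cancel_right₀ _ (by positivity)]
  congr 1
  rw [show 2 * m / 2 = m by omega]
  rcases lt_or_ge n m with hnm | hnm
  · rw [if_pos (by omega), if_pos hnm, one_pow]
  · rw [if_neg (by omega), if_neg (by omega), if_neg (by omega), mul_pow, Real.sq_sqrt hα]
    norm_num

/-- At `n = j`, Pochhammer reflection pairs the six factors of the radicand into three squares, with
no sign because `j` is even. -/
theorem prodU_half_top : prodU a b (1 / 2) (2 * m) (4 * m) = hTop a b (2 * m) ^ 2 := by
  have hp := poch_half_odd_ne_zero m (2 * m)
  have hE := prodU_half_eq_evenRadicand a b m (2 * m)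
  have he : ((-1 : ℝ)) ^ (2 * m) = 1 := (even_two_mul m).neg_one_pow
  have r1 := poch_reflect (-((2 * m : ℕ) : ℝ)) (2 * m)
  have r2 := poch_reflect ((1 - b - (2 * m : ℕ)) / 2) (2 * m)
  have r3 := poch_reflect ((2 + a - (2 * m : ℕ)) / 2) (2 * m)
  rw [he, one_mul] at r1 r2 r3
  rw [show (1 : ℝ) - (2 * m : ℕ) - -(2 * m : ℕ) = 1 by ring] at r1
  rw [show (1 : ℝ) - (2 * m : ℕ) - (1 - b - (2 * m : ℕ)) / 2 = (b + 1 - (2 * m : ℕ)) / 2 by ring] at r2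
  rw [show (1 : ℝ) - (2 * m : ℕ) - (2 + a - (2 * m : ℕ)) / 2 = -(((2 * m : ℕ) + a) / 2) by ring] at r3
  rw [hTop, div_pow, eq_div_iff (by positivity), show 4 * m = 2 * (2 * m) by ring, hE, evenRadicand,
    r1, r2, r3, add_comm 1 b]
  ring

/-- Needed to choose the positive root; the three sign-changing Pochhammer symbols are compared
factor by factor. -/
theorem Admissible.hTop_pos (h : Admissible a b m) : 0 < hTop a b (2 * m) := by
  have h1 : 0 < poch 1 (2 * m) := by
    rw [poch_eq_prod]; exact Finset.prod_pos fun i _ => by positivity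
  have key : 0 < poch ((b + 1 - (2 * m : ℕ)) / 2) (2 * m) * poch (-(((2 * m : ℕ) + a) / 2)) (2 * m) /
      poch ((1 - ((2 * m : ℕ) : ℝ)) / 2) (2 * m) := by
    rw [poch_eq_prod, poch_eq_prod, poch_eq_prod, ← Finset.prod_mul_distrib, ← Finset.prod_div_distrib]
    refine Finset.prod_pos fun i _ => ?_
    have hi : (0 : ℝ) ≤ i := i.cast_nonneg
    simp only [Admissible, abs_lt] at h
    push_cast
    rcases Nat.lt_or_ge i m with him | him
    · have h1 : (i : ℝ) + 1 ≤ m := by exact_mod_cast him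
      refine div_pos_of_neg_of_neg ?_ (by linarith)
      rcases h with ⟨h, h'⟩ | ⟨h, h'⟩
      · exact mul_neg_of_neg_of_pos (by linarith) (by linarith)
      · exact mul_neg_of_pos_of_neg (by linarith) (by linarith)
    · have h1 : (m : ℝ) ≤ i := by exact_mod_cast him
      refine div_pos ?_ (by linarith)
      rcases h with ⟨h, h'⟩ | ⟨h, h'⟩
      · exact mul_pos (by linarith) (by linarith)
      · exact mul_pos (by linarith) (by linarith)
  have : hTop a b (2 * m) = poch 1 (2 * m) / 2 ^ (2 * (2 * m)) *
      (poch ((b + 1 - (2 * m : ℕ)) / 2) (2 * m) * poch (-(((2 * m : ℕ) + a) / 2)) (2 * m) /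
      poch ((1 - ((2 * m : ℕ) : ℝ)) / 2) (2 * m)) := by
    rw [hTop, div_mul_div_comm, mul_assoc]
  rw [this]
  positivity

theorem Admissible.sqrt_prodU_half_top (h : Admissible a b m) :
    √(prodU a b (1 / 2) (2 * m) (4 * m)) = hTop a b (2 * m) := by
  rw [prodU_half_top, Real.sqrt_sq h.hTop_pos.le]

/-- Reflection makes `u_1 ⋯ u_{4m}` at `α = 1/2` a quarter of the square of the left side, so the
squares agree; positivity of `u_1 ⋯ u_{2m}` fixes the sign. -/
theorem Admissible.midCoupling_mul_prodU (h : Admissible a b m) (hm : 0 < m) (α : ℝ) :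
    midCoupling a b m * prodU a b α (2 * m) (2 * m - 1) = 2 * hTop a b (2 * m) := by
  have e : prodU a b α (2 * m) (2 * m - 1) = prodU a b (1 / 2) (2 * m) (2 * m - 1) := by
    rw [prodU_eq_half a b α hm, if_pos (by omega), mul_one]
  rw [e]
  have hp := h.prodU_half_pos (n := 2 * m - 1 + 1) (by omega)
  rw [prodU_succ, show 2 * m - 1 + 1 = 2 * m by omega, coeffU_mid _ _ _ _ hm] at hp
  have hsq := prodU_full (a := a) (b := b) (α := 1 / 2) hm
  rw [prodU_half_top] at hsq
  have : (midCoupling a b m * prodU a b (1 / 2) (2 * m) (2 * m - 1)) ^ 2 =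
      (2 * hTop a b (2 * m)) ^ 2 := by linear_combination -4 * hsq
  exact (pow_left_inj₀ (by linarith) (by linarith [h.hTop_pos]) two_ne_zero).1 this

end Norms

/-! ### Weights, endpoint values of `α`, partial sums -/

section Weights

variable {a b : ℝ} {m : ℕ}

theorem Admissible.derivative_nodal_ne_zero (h : Admissible a b m) {i : ℕ} (hi : i ≤ 4 * m) :
    (∏ k ∈ Finset.range (4 * m + 1), (X - C (grid a b (2 * m) k))).derivative.eval
      (grid a b (2 * m) i) ≠ 0 := by
  rw [← Lagrange.nodal_eq, Lagrange.eval_nodal_derivative_eval_node_eq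
    (Finset.mem_range.2 (Nat.lt_succ_of_le hi))]
  refine Lagrange.eval_nodal_not_at_node fun k hk e => Finset.ne_of_mem_erase hk ?_
  exact h.grid_injOn (Set.mem_Iic.2 (Nat.lt_succ_iff.1 (Finset.mem_range.1
    (Finset.mem_of_mem_erase hk)))) (Set.mem_Iic.2 hi) e.symm

/-- On even points `P_{4m}` is `2(1-α)` times `hTop`, on odd points `-2α` times it, while the full
product is `4α(1-α)` times its square. The quotient explains the factors `2α`, `2(1-α)` and the
alternating sign; the multiplied form avoids division at the endpoints. -/
theorem Admissible.weight_mul (h : Admissible a b m) (hm : 0 < m) (α : ℝ) {i : ℕ}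
    (hi : i ≤ 4 * m) :
    weight a b α (2 * m) i * ((paraP a b α (2 * m) (4 * m)).eval (grid a b (2 * m) i) *
      (paraP a b α (2 * m) (4 * m + 1)).derivative.eval (grid a b (2 * m) i)) =
        prodU a b α (2 * m) (4 * m) := by
  have hD := h.derivative_nodal_ne_zero hi
  rw [(paraP_eval_grid α hm hi).2, h.paraP_eq_prod α hm, prodU_full hm, h.midCoupling_mul_prodU hm,
    weight, persymWeight_eq hi]
  split_ifs with hp
  · rw [hp.neg_one_pow]
    field_simp
  · rw [(Nat.not_even_iff_odd.1 hp).neg_one_pow]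
    field_simp

theorem Admissible.weight_eq_div (h : Admissible a b m) (hm : 0 < m) {α : ℝ} (h0 : 0 < α)
    (h1 : α < 1) {i : ℕ} (hi : i ≤ 4 * m) :
    weight a b α (2 * m) i = prodU a b α (2 * m) (4 * m) /
      ((paraP a b α (2 * m) (4 * m)).eval (grid a b (2 * m) i) *
        (paraP a b α (2 * m) (4 * m + 1)).derivative.eval (grid a b (2 * m) i)) := by
  rw [eq_div_iff, h.weight_mul hm α hi]
  rw [(paraP_eval_grid α hm hi).2, h.paraP_eq_prod α hm, h.midCoupling_mul_prodU hm]
  refine mul_ne_zero (mul_ne_zero ?_ (mul_ne_zero two_ne_zero h.hTop_pos.ne'))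
    (h.derivative_nodal_ne_zero hi)
  split_ifs
  · linarith
  · linarith

theorem continuous_coeffA (a b : ℝ) (j n : ℕ) : Continuous fun α => coeffA a b α j n := by
  unfold coeffA
  split_ifs <;> fun_prop

theorem continuous_coeffC (a b : ℝ) (j n : ℕ) : Continuous fun α => coeffC a b α j n := by
  unfold coeffC
  split_ifs <;> fun_prop

theorem continuous_coeffU (a b : ℝ) (j n : ℕ) : Continuous fun α => coeffU a b α j n := by
  cases n with
  | zero => exact continuous_const
  | succ n => exact (continuous_coeffA a b j n).mul (continuous_coeffC a b j (n + 1))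

theorem continuous_prodU (a b : ℝ) (j n : ℕ) : Continuous fun α => prodU a b α j n :=
  continuous_finsetProd _ fun k _ => continuous_coeffU a b j k

theorem continuous_weight (a b : ℝ) (j n : ℕ) : Continuous fun α => weight a b α j n := by
  unfold weight
  split_ifs <;> fun_prop

theorem continuous_paraP_eval (a b : ℝ) (j n : ℕ) (x : ℝ) :
    Continuous fun α => (paraP a b α j n).eval x := by
  induction n using Nat.strong_induction_on with
  | _ n ih =>
  cases n with
  | zero => simpa [paraP] using continuous_const
  | succ n =>
    simp only [paraP_eval_succ, coeffDiag]
    have h1 := ih n (by omega)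
    have h2 := ih (n - 1) (by omega)
    have h3 := continuous_coeffA a b j n
    have h4 := continuous_coeffC a b j n
    have h5 := continuous_coeffU a b j n
    fun_prop

theorem Admissible.orthogonality (h : Admissible a b m) (hm : 0 < m) {α : ℝ} (h0 : 0 ≤ α)
    (h1 : α ≤ 1) {k l : ℕ} (hk : k ≤ 4 * m) (hl : l ≤ 4 * m) :
    ∑ s ∈ Finset.range (4 * m + 1), weight a b α (2 * m) s *
        (paraP a b α (2 * m) k).eval (grid a b (2 * m) s) *
        (paraP a b α (2 * m) l).eval (grid a b (2 * m) s) =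
      if k = l then prodU a b α (2 * m) k else 0 := by
  have hopen : Set.EqOn (fun α => ∑ s ∈ Finset.range (4 * m + 1), weight a b α (2 * m) s *
        (paraP a b α (2 * m) k).eval (grid a b (2 * m) s) *
        (paraP a b α (2 * m) l).eval (grid a b (2 * m) s))
      (fun α => if k = l then prodU a b α (2 * m) k else 0) (Set.Ioo 0 1) := fun α hα =>
    orthogonality_of_zeros (grid a b (2 * m)) (weight a b α (2 * m))
      (fun i hi hi' => h.coeffU_ne_zero hm hα.1 hα.2 hi hi') h.grid_injOn
      (fun i hi => (paraP_eval_grid α hm hi).1) (fun i hi => h.weight_mul hm α hi) hk hl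
  -- At `α = 0` or `1` a coefficient `u_n` vanishes and the matrix argument fails. The grid is
  -- independent of `α` and both sides are continuous in it, so the identity extends to the closed
  -- interval.
  have hc := hopen.closure
    (continuous_finsetSum _ fun s _ => ((continuous_weight a b _ s).mul
      (continuous_paraP_eval a b _ k _)).mul (continuous_paraP_eval a b _ l _))
    (by split_ifs; exacts [continuous_prodU a b _ k, continuous_const])
  rw [closure_Ioo zero_ne_one] at hc
  exact hc ⟨h0, h1⟩

theorem sum_range_even_odd (f : ℕ → ℝ) (n : ℕ) :
    ∑ k ∈ Finset.range (2 * n + 1), f k =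
      ∑ s ∈ Finset.range (n + 1), f (2 * s) + ∑ s ∈ Finset.range n, f (2 * s + 1) := by
  induction n with
  | zero => simp
  | succ n ih =>
    rw [show 2 * (n + 1) + 1 = 2 * n + 1 + 1 + 1 by ring, Finset.sum_range_succ,
      Finset.sum_range_succ, ih, Finset.sum_range_succ (fun s => f (2 * s)) (n + 1),
      Finset.sum_range_succ (fun s => f (2 * s + 1)), show 2 * (n + 1) = 2 * n + 1 + 1 by ring]
    ring

theorem weight_two_mul (a b α : ℝ) (j s : ℕ) :
    weight a b α j (2 * s) = 2 * α * persymWeight a b j (2 * s) :=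
  if_pos (even_two_mul s)

theorem weight_two_mul_add_one (a b α : ℝ) (j s : ℕ) :
    weight a b α j (2 * s + 1) = 2 * (1 - α) * persymWeight a b j (2 * s + 1) :=
  if_neg (Nat.not_even_iff_odd.2 (odd_two_mul_add_one s))

theorem Admissible.sum_persymWeight (h : Admissible a b m) (hm : 0 < m) {α : ℝ} (h0 : 0 ≤ α)
    (h1 : α ≤ 1) :
    2 * α * ∑ s ∈ Finset.range (2 * m + 1), persymWeight a b (2 * m) (2 * s) +
      2 * (1 - α) * ∑ s ∈ Finset.range (2 * m), persymWeight a b (2 * m) (2 * s + 1) = 1 := by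
  have e := h.orthogonality hm h0 h1 (Nat.zero_le _) (Nat.zero_le _)
  rw [show 4 * m + 1 = 2 * (2 * m) + 1 by ring, sum_range_even_odd] at e
  simp only [paraP, eval_one, mul_one, weight_two_mul, weight_two_mul_add_one,
    ← Finset.mul_sum, if_true] at e
  simpa [prodU] using e

end Weights

end ParaBI

theorem mainTheorem4 (j : ℕ) (hj : Even j) (hj2 : 2 ≤ j) (a b α : ℝ)
    (hα0 : 0 ≤ α) (hα1 : α ≤ 1)
    (hab : (a < -(j : ℝ) ∧ |b| < 1) ∨ ((j : ℝ) - 1 < b ∧ |a + 1| < 1)) :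
    -- the grid points are pairwise distinct and are the zeros of `P_{2j+1}`
    (Set.InjOn (ParaBI.grid a b j) (Set.Iic (2 * j)) ∧
      ParaBI.paraP a b α j (2 * j + 1) =
        ∏ s ∈ Finset.range (2 * j + 1),
          (Polynomial.X - Polynomial.C (ParaBI.grid a b j s))) ∧
    -- orthogonality relation
    (∀ n ≤ 2 * j, ∀ m ≤ 2 * j,
      ∑ s ∈ Finset.range (2 * j + 1), ParaBI.weight a b α j s
          * (ParaBI.paraP a b α j n).eval (ParaBI.grid a b j s)
          * (ParaBI.paraP a b α j m).eval (ParaBI.grid a b j s)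
        = if n = m then ParaBI.prodU a b α j n else 0) ∧
    -- the weights are those of the general theory of orthogonal polynomials
    (0 < α → α < 1 → ∀ s ≤ 2 * j,
      ParaBI.weight a b α j s = ParaBI.prodU a b α j (2 * j)
        / ((ParaBI.paraP a b α j (2 * j)).eval (ParaBI.grid a b j s)
          * (ParaBI.paraP a b α j (2 * j + 1)).derivative.eval (ParaBI.grid a b j s))) ∧
    -- the persymmetric weights, i.e. those at `α = 1/2`
    (∀ s ≤ 2 * j,
      ParaBI.persymWeight a b j s = (-1) ^ s * √(ParaBI.prodU a b (1 / 2) j (2 * j))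
        / (ParaBI.paraP a b (1 / 2) j (2 * j + 1)).derivative.eval (ParaBI.grid a b j s)) ∧
    √(ParaBI.prodU a b (1 / 2) j (2 * j)) = ParaBI.hTop a b j ∧
    -- partial sums of the weights
    (∑ s ∈ Finset.range (j + 1), ParaBI.weight a b α j (2 * s) = α ∧
      ∑ s ∈ Finset.range j, ParaBI.weight a b α j (2 * s + 1) = 1 - α) ∧
    -- explicit norms
    ((∀ n ≤ j, ParaBI.prodU a b α j (2 * n) = ParaBI.normEven a b α j n ^ 2) ∧
      (∀ n < j, ParaBI.prodU a b α j (2 * n + 1) = ParaBI.normOdd a b α j n ^ 2)) := by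
  obtain ⟨m, rfl⟩ : ∃ m, j = 2 * m := hj.exists_two_nsmul.imp fun m h => by simpa using h
  have hm : 0 < m := by omega
  have h : ParaBI.Admissible a b m := by simpa [ParaBI.Admissible] using hab
  rw [show 2 * (2 * m) = 4 * m by ring]
  -- The persymmetric sums do not involve `α`, so total mass one at the endpoints shows that each of
  -- them is `1/2`.
  have hsum0 := h.sum_persymWeight hm (le_refl (0 : ℝ)) zero_le_one
  have hsum1 := h.sum_persymWeight hm zero_le_one (le_refl (1 : ℝ))
  refine ⟨⟨h.grid_injOn, h.paraP_eq_prod α hm⟩,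
    fun n hn k hk => h.orthogonality hm hα0 hα1 hn hk,
    fun h0 h1 s hs => h.weight_eq_div hm h0 h1 hs, fun s hs => ?_,
    h.sqrt_prodU_half_top, ⟨?_, ?_⟩,
    fun n hn => h.prodU_eq_normEven_sq hm hα0 hα1 hn,
    fun n hn => h.prodU_eq_normOdd_sq hm hα0 hα1 hn⟩
  · rw [h.paraP_eq_prod _ hm, h.sqrt_prodU_half_top, ParaBI.persymWeight_eq hs]
  · simp only [ParaBI.weight_two_mul, ← Finset.mul_sum]
    linear_combination α * hsum1
  · simp only [ParaBI.weight_two_mul_add_one, ← Finset.mul_sum]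
    linear_combination (1 - α) * hsum0
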